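/- Let $M$ be a (Hausdorff) complex manifold of dimension $N$ and let $F$ be a holomorphic vector field on $M$. An integral curve of $F$ is a holomorphic map $\gamma:U\to M$, $U\subset\mathbb C$ open, with $\gamma'(\zeta)=F(\gamma(\zeta))$; the maximal integral curve of $F$ through $p\in M$ is the set of all points that can be reached from $p$ along finitely many successive integral curves with connected domains (the leaf through $p$). A function $\phi:M\to\mathbb C$ is called $F$-holomorphic if $\phi\circ\gamma$ is holomorphic for every integral curve $\gamma$ of $F$. We say that $\phi$ has a Taylor series at $z_0\in M$ if, in local holomorphic coordinates $z=(z_1,\dots,z_N)$ centred at $z_0$, there is a formal series $\sum_{j\ge 0}\sum_{|k|+|m|=j}a_{km}z^k\overline z^m$ such that for every $n\ge 0$ $$\Big|\phi(z)-\sum_{j=0}^n\sum_{|k|+|m|=j}a_{km}z^k\overline z^m\Big|=o(|z|^n)\qquad (z\to 0).$$ For a critical point (zero) $z_0$ of $F$ let $\operatorname{Sat}(z_0,F)$ be the union of all maximal integral curves of $F$ that meet every open neighborhood of $z_0$. **Theorem 6.2.** Suppose that $z_0$ is an isolated critical point of $F$ and that $F$ is linearizable at $z_0$, i.e. there is a biholomorphic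 map of a neighborhood of $z_0$ onto an open subset of $\mathbb C^N$ in whose coordinates $w$ the field is $F(w)=Aw$ for some $N\times N$-matrix $A$. Suppose that $A$ is diagonal and that the ratios $\alpha_j/\alpha_k$ of all eigenvalues of $A$ are positive real numbers. If an $F$-holomorphic function $\phi:M\to\mathbb C$ has a Taylor series at $z_0$, then $\operatorname{Sat}(z_0,F)$ is open and $\phi$ is holomorphic on $\operatorname{Sat}(z_0,F)$. -/

import Mathlib

open scoped Manifold ContDiff Topology

noncomputable section

namespace FHol

/-- The model space `ℂ^N`. Only its topology, its complex structure and the order of magnitude of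
its norm are used below, so the choice among the (equivalent) norms is immaterial. -/
abbrev CN (N : ℕ) : Type := Fin N → ℂ

/-- The usual normed space structure (recorded so that instance search takes the direct path). -/
instance instNormedSpaceCN (N : ℕ) : NormedSpace ℂ (CN N) := Pi.normedSpace

/-- The monomial `z^k = z₁^{k₁} ⋯ z_N^{k_N}`. -/
def monom {N : ℕ} (z : CN N) (k : Fin N → ℕ) : ℂ := ∏ i, z i ^ k i

/-- The homogeneous part `∑_{|k| + |m| = j} a_{km} z^k z̄^m` of degree `j`. -/
def taylorPart {N : ℕ} (a : (Fin N → ℕ) → (Fin N → ℕ) → ℂ) (j : ℕ) (z : CN N) : ℂ :=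
  ∑ d ∈ Finset.HasAntidiagonal.antidiagonal j,
    ∑ k ∈ Finset.piAntidiag (Finset.univ : Finset (Fin N)) d.1,
      ∑ m ∈ Finset.piAntidiag (Finset.univ : Finset (Fin N)) d.2,
        a k m * monom z k * monom (fun i => (starRingEnd ℂ) (z i)) m

/-- `f` has a Taylor series at the origin of `ℂ^N`: there is a formal series in `z` and `z̄`
whose partial sum of degree `n` approximates `f` up to `o(|z|^n)`, for every `n`. -/
def HasTaylorSeriesAtZero {N : ℕ} (f : CN N → ℂ) : Prop :=
  ∃ a : (Fin N → ℕ) → (Fin N → ℕ) → ℂ, ∀ n : ℕ,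
    (fun z : CN N => f z - ∑ j ∈ Finset.range (n + 1), taylorPart a j z)
      =o[𝓝 0] (fun z : CN N => ‖z‖ ^ n)

section Manifold

variable {N : ℕ} {M : Type*} [TopologicalSpace M] [ChartedSpace (CN N) M]

/-- A function on a complex manifold has a Taylor series at `z₀` if it has one in some system of
local holomorphic coordinates centred at `z₀` (the notion does not depend on that system). -/
def HasTaylorSeriesAt (N : ℕ) {M : Type*} [TopologicalSpace M] [ChartedSpace (CN N) M]
    (φ : M → ℂ) (z₀ : M) : Prop :=
  ∃ e ∈ IsManifold.maximalAtlas 𝓘(ℂ, CN N) ω M,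
    z₀ ∈ e.source ∧ e z₀ = 0 ∧ HasTaylorSeriesAtZero (fun w : CN N => φ (e.symm w))

/-- `γ` restricted to the open set `U ⊆ ℂ` is a (complex) integral curve of `F`:
`γ'(ζ) = F(γ(ζ))` for complex time `ζ ∈ U`. -/
def IsIntegralCurveOn (F : (z : M) → TangentSpace 𝓘(ℂ, CN N) z) (γ : ℂ → M) (U : Set ℂ) : Prop :=
  IsOpen U ∧ ∀ ζ ∈ U, HasMFDerivAt 𝓘(ℂ, ℂ) 𝓘(ℂ, CN N) γ ζ
    ((1 : ℂ →L[ℂ] ℂ).smulRight (F (γ ζ)))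

/-- `φ` is holomorphic along `F`: its restriction to every integral curve is holomorphic. -/
def IsFHolomorphic (F : (z : M) → TangentSpace 𝓘(ℂ, CN N) z) (φ : M → ℂ) : Prop :=
  ∀ (γ : ℂ → M) (U : Set ℂ), IsIntegralCurveOn F γ U → DifferentiableOn ℂ (φ ∘ γ) U

/-- `p` and `q` lie on the image of one integral curve defined on a connected open subset
of `ℂ`. -/
def OnCommonCurve (F : (z : M) → TangentSpace 𝓘(ℂ, CN N) z) (p q : M) : Prop :=
  ∃ (γ : ℂ → M) (U : Set ℂ), IsIntegralCurveOn F γ U ∧ IsPreconnected U ∧ p ∈ γ '' U ∧ q ∈ γ '' U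

/-- The maximal integral curve (leaf) through `p`. A maximal integral curve of a holomorphic field
need not be parametrized by a subset of `ℂ` (analytic continuation in complex time may be
multivalued), so it consists of all points that are reached from `p` along finite chains of
integral curves. The leaf of a critical point is that point. -/
def leaf (F : (z : M) → TangentSpace 𝓘(ℂ, CN N) z) (p : M) : Set M :=
  {q | Relation.ReflTransGen (OnCommonCurve F) p q}

/-- `L` is (the underlying set of) a maximal integral curve of `F`. -/
def IsMaximalIntegralCurve (F : (z : M) → TangentSpace 𝓘(ℂ, CN N) z) (L : Set M) : Prop :=
  ∃ p : M, L = leaf F p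

/-- The saturation `Sat(z₀, F)`: the union of all maximal integral curves of `F` that meet every
open neighbourhood of `z₀`. -/
def Sat (F : (z : M) → TangentSpace 𝓘(ℂ, CN N) z) (z₀ : M) : Set M :=
  ⋃₀ {L | IsMaximalIntegralCurve F L ∧ ∀ U : Set M, IsOpen U → z₀ ∈ U → (L ∩ U).Nonempty}

/-- `z₀` is an isolated critical point (zero) of `F`. -/
def IsIsolatedCriticalPoint (F : (z : M) → TangentSpace 𝓘(ℂ, CN N) z) (z₀ : M) : Prop :=
  F z₀ = 0 ∧ ∀ᶠ z in 𝓝[≠] z₀, F z ≠ 0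

/-- `F` is linearizable at `z₀` with linearization matrix `A`: there is a biholomorphic map `Φ` of
an open neighbourhood of `z₀` onto an open subset of `ℂ^N` that carries `F` to the field
`w ↦ A w`. -/
def IsLinearizableAt (F : (z : M) → TangentSpace 𝓘(ℂ, CN N) z) (z₀ : M)
    (A : Matrix (Fin N) (Fin N) ℂ) : Prop :=
  ∃ Φ ∈ IsManifold.maximalAtlas 𝓘(ℂ, CN N) ω M, z₀ ∈ Φ.source ∧
    ∀ z ∈ Φ.source,
      (mfderiv 𝓘(ℂ, CN N) 𝓘(ℂ, CN N) Φ z (F z) : CN N) = A.mulVec (Φ z)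

/-- `F` is a holomorphic (that is, complex analytic) vector field. -/
def IsHolomorphicField [IsManifold 𝓘(ℂ, CN N) ω M]
    (F : (z : M) → TangentSpace 𝓘(ℂ, CN N) z) : Prop :=
  ContMDiff 𝓘(ℂ, CN N) (𝓘(ℂ, CN N)).tangent ω
    (fun z => (⟨z, F z⟩ : TangentBundle 𝓘(ℂ, CN N) M))

end Manifold

end FHol

end

section

open scoped NNReal
open Filter Metric Set MeasureTheory

/-! In a linearizing chart the field is `x_j ↦ c r_j x_j` with `c ≠ 0` and all `r_j ≥ ρ > 0`. After
rescaling complex time its flow is `w_j ↦ exp (-(r_j ζ)) w_j`, which for `Re ζ ≥ 0` maps balls about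
`0` into themselves and contracts them to `0` as `Re ζ → ∞`. The proof has two halves: `φ` is
holomorphic near `z₀`, and holomorphy travels along leaves.

Near `z₀`, fix `w` and let `g ζ` be `φ` at the flowed point. It is holomorphic and bounded by some
`C` on the right half-plane, and the Taylor expansion of order `n` turns into a finite sum of terms
`b exp (-(λ ζ + μ ζ̄))` with error `O(exp (-nρ Re ζ))`. Holomorphy of `g` kills the terms with `μ ≠
0` and `λ + μ < nρ` (`coeff_eq_zero_of_norm_sub_sum_le`), and `C` bounds each surviving coefficient
(`coeff_norm_le_of_norm_sub_sum_le`). Phragmén–Lindelöf then bounds the error by `C (1 + number of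
terms) exp (-nρ Re ζ)` (`norm_sub_sum_le_of_norm_sub_sum_expTerm_le`). The Taylor remainder
constants, uncontrolled in `n`, have disappeared. There are at most `(n + 1)^N` terms, so at `ζ = 1`
holomorphic polynomials in `w` converge uniformly to `φ` composed with the time-one flow. Undoing
this invertible linear map gives holomorphy near `z₀`; the points there flow into `z₀`, so they
belong to the saturation.

For the propagation, write `φ` in flow coordinates `(s, q)`. It is holomorphic in the time `s` for
every `q`, and jointly holomorphic near one time. Hartogs' lemma, applied to its Taylor coefficients
in `s`, extends holomorphy in `q` to the other times (`exists_differentiableOn_of_separately`).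
Hence the set of regular points is open and closed along every integral curve. Each leaf in the
saturation meets the regular neighbourhood of `z₀`, so it is regular throughout. -/

/-! ### Cauchy estimates and uniform limits of holomorphic maps -/

theorem norm_fderiv_le_of_forall_mem_ball_norm_le {E G : Type*} [NormedAddCommGroup E]
    [NormedSpace ℂ E] [NormedAddCommGroup G] [NormedSpace ℂ G] {f : E → G} {x : E} {r R C : ℝ}
    (hr : 0 < r) (hrR : r < R) (hf : DifferentiableOn ℂ f (ball x R))
    (hC : ∀ y ∈ ball x R, ‖f y‖ ≤ C) : ‖fderiv ℂ f x‖ ≤ C / r := by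
  have hR : 0 < R := hr.trans hrR
  have hC0 : 0 ≤ C := (norm_nonneg _).trans (hC x (mem_ball_self hR))
  refine ContinuousLinearMap.opNorm_le_bound _ (by positivity) fun v => ?_
  rcases eq_or_ne v 0 with rfl | hv
  · simp
  have hv' : 0 < ‖v‖ := norm_pos_iff.2 hv
  -- On the complex line through `x` in direction `v` this is the one-variable Cauchy estimate for
  -- the disc of radius `r / ‖v‖`.
  have hmem : ∀ z : ℂ, z ∈ closedBall (0 : ℂ) (r / ‖v‖) → x + z • v ∈ ball x R := by
    intro z hz
    rw [mem_closedBall_zero_iff, le_div_iff₀ hv'] at hz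
    rw [mem_ball_iff_norm, add_sub_cancel_left, norm_smul]
    exact hz.trans_lt hrR
  have hd : ∀ z ∈ closedBall (0 : ℂ) (r / ‖v‖),
      HasDerivAt (fun z : ℂ => f (x + z • v)) (fderiv ℂ f (x + z • v) v) z := by
    intro z hz
    have h1 : HasDerivAt (fun z : ℂ => x + z • v) v z := by
      simpa using ((hasDerivAt_id z).smul_const v).const_add x
    exact ((hf.differentiableAt (isOpen_ball.mem_nhds (hmem z hz))).hasFDerivAt).comp_hasDerivAt
      z h1
  have hcl : DiffContOnCl ℂ (fun z : ℂ => f (x + z • v)) (ball 0 (r / ‖v‖)) := by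
    refine DifferentiableOn.diffContOnCl fun z hz => ?_
    exact (hd z (closure_ball_subset_closedBall hz)).differentiableAt.differentiableWithinAt
  have key := Complex.norm_deriv_le_of_forall_mem_sphere_norm_le (by positivity) hcl
    (fun z hz => hC _ (hmem z (sphere_subset_closedBall hz)))
  rw [(hd 0 (mem_closedBall_self (by positivity))).deriv] at key
  simp only [zero_smul, add_zero] at key
  calc _ ≤ C / (r / ‖v‖) := key
    _ = C / r * ‖v‖ := by field_simp

/-- A uniform limit of holomorphic functions on an open subset of a complex normed space is
holomorphic. -/
theorem TendstoUniformlyOn.differentiableOn_of_complex {E G : Type*} [NormedAddCommGroup E]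
    [NormedSpace ℂ E] [NormedAddCommGroup G] [NormedSpace ℂ G] [CompleteSpace G]
    {f : ℕ → E → G} {g : E → G} {s : Set E} (hs : IsOpen s)
    (hf : ∀ n, DifferentiableOn ℂ (f n) s) (h : TendstoUniformlyOn f g atTop s) :
    DifferentiableOn ℂ g s := by
  intro x hx
  obtain ⟨R, hR, hRs⟩ := Metric.isOpen_iff.1 hs x hx
  have hsub : ∀ y ∈ ball x (R / 2), ball y (R / 2) ⊆ s := fun y hy =>
    (ball_subset_ball' (by rw [mem_ball] at hy; linarith)).trans hRs
  have hys : ∀ y ∈ ball x (R / 2), y ∈ s := fun y hy => hsub y hy (mem_ball_self (by positivity))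
  -- The Cauchy estimate for `f m - f n` makes the derivatives uniformly Cauchy on the smaller ball,
  -- so the limit may be differentiated.
  have hcau : UniformCauchySeqOn (fun n => fderiv ℂ (f n)) atTop (ball x (R / 2)) := by
    rw [Metric.uniformCauchySeqOn_iff]
    intro ε hε
    obtain ⟨n₀, hn₀⟩ := Metric.uniformCauchySeqOn_iff.1 h.uniformCauchySeqOn (ε / 2 * (R / 4))
      (by positivity)
    refine ⟨n₀, fun m hm n hn y hy => ?_⟩
    have hdm := (hf m).mono (hsub y hy)
    have hdn := (hf n).mono (hsub y hy)
    have hy' : ball y (R / 2) ∈ 𝓝 y := ball_mem_nhds y (by positivity)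
    rw [dist_eq_norm, ← fderiv_fun_sub (hdm.differentiableAt hy') (hdn.differentiableAt hy')]
    refine (norm_fderiv_le_of_forall_mem_ball_norm_le (r := R / 4) (R := R / 2)
      (C := ε / 2 * (R / 4)) (by positivity) (by linarith) (hdm.sub hdn) fun z hz => ?_).trans_lt ?_
    · rw [Pi.sub_apply, ← dist_eq_norm]
      exact (hn₀ m hm n hn z (hsub y hy hz)).le
    · rw [mul_div_cancel_right₀ _ (by positivity)]
      linarith
  have hlim : ∀ y ∈ ball x (R / 2), ∃ L, Tendsto (fun n => fderiv ℂ (f n) y) atTop (𝓝 L) :=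
    fun y hy => cauchySeq_tendsto_of_complete (hcau.cauchySeq hy)
  choose! g' hg' using hlim
  exact (hasFDerivAt_of_tendstoUniformlyOn isOpen_ball
    (hcau.tendstoUniformlyOn_of_tendsto hg')
    (fun n y hy => ((hf n).differentiableAt (hs.mem_nhds (hys y hy))).hasFDerivAt)
    (fun y hy => h.tendsto_at (hys y hy))
    (mem_ball_self (by positivity))).differentiableAt.differentiableWithinAt

/-! ### Exponential sums that approximate a bounded holomorphic function -/

/-- The exponential `ζ ↦ exp (-(λ ζ + μ ζ̄))`. -/
noncomputable def expTerm (p : ℝ × ℝ) (ζ : ℂ) : ℂ :=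
  Complex.exp (-(p.1 * ζ + p.2 * (starRingEnd ℂ) ζ))

theorem expTerm_add (p : ℝ × ℝ) (ζ a : ℂ) : expTerm p (ζ + a) = expTerm p ζ * expTerm p a := by
  rw [expTerm, expTerm, expTerm, ← Complex.exp_add, map_add]
  ring_nf

theorem norm_expTerm (p : ℝ × ℝ) (ζ : ℂ) : ‖expTerm p ζ‖ = Real.exp (-((p.1 + p.2) * ζ.re)) := by
  rw [expTerm, Complex.norm_exp]
  simp
  ring

theorem expTerm_fst_zero (t : ℝ) (ζ : ℂ) : expTerm (t, 0) ζ = Complex.exp (-(t * ζ)) := by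
  simp [expTerm]

theorem expTerm_mul_I (p : ℝ × ℝ) (s : ℝ) :
    expTerm p (s * Complex.I) = Complex.exp (-((p.1 - p.2) * s * Complex.I)) := by
  rw [expTerm]
  simp
  ring_nf

theorem expTerm_pi_div_mul_I {p q : ℝ × ℝ} (h : p.1 - p.2 - (q.1 - q.2) ≠ 0) :
    expTerm p ((Real.pi / (p.1 - p.2 - (q.1 - q.2)) : ℝ) * Complex.I)
      = -expTerm q ((Real.pi / (p.1 - p.2 - (q.1 - q.2)) : ℝ) * Complex.I) := by
  have hd : (p.1 - p.2 - (q.1 - q.2) : ℂ) ≠ 0 := by exact_mod_cast h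
  rw [expTerm_mul_I, expTerm_mul_I]
  have : -(((p.1 : ℂ) - p.2) * (Real.pi / (p.1 - p.2 - (q.1 - q.2)) : ℝ) * Complex.I)
      = -((q.1 - q.2) * (Real.pi / (p.1 - p.2 - (q.1 - q.2)) : ℝ) * Complex.I)
        - Real.pi * Complex.I := by
    push_cast
    field_simp
    ring
  rw [this, Complex.exp_sub, Complex.exp_pi_mul_I, div_neg, div_one]

theorem expTerm_ne_zero (p : ℝ × ℝ) (ζ : ℂ) : expTerm p ζ ≠ 0 := Complex.exp_ne_zero _

/-- `expTerm p` is a character of the additive group `ℂ`, and distinct `p` differ in modulus on the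
real axis or in phase on the imaginary axis. The sign of `a.re` makes translation by `a` preserve
the half-plane. -/
theorem exists_expTerm_ne {p q : ℝ × ℝ} (h : p ≠ q) :
    ∃ a : ℂ, 0 ≤ a.re ∧ expTerm p a ≠ expTerm q a := by
  by_cases hs : p.1 + p.2 = q.1 + q.2
  · have hd : p.1 - p.2 - (q.1 - q.2) ≠ 0 := by
      intro hd
      exact h (Prod.ext (by linarith) (by linarith))
    refine ⟨(Real.pi / (p.1 - p.2 - (q.1 - q.2)) : ℝ) * Complex.I,
      by rw [Complex.re_ofReal_mul]; simp, fun he => ?_⟩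
    rw [expTerm_pi_div_mul_I hd, neg_eq_self] at he
    exact expTerm_ne_zero _ _ he
  · refine ⟨1, by simp, fun he => hs ?_⟩
    have := congrArg norm he
    rw [norm_expTerm, norm_expTerm, Real.exp_eq_exp] at this
    simp at this
    linarith

/-- Multiply `h` by `exp ((p.1 + p.2) z)` and translate by `n`. The results are holomorphic and,
because `p.1 + p.2 < κ`, converge uniformly to `c exp (p.2 (z - z̄))`, which is then holomorphic. As
it depends on `Im z` only, and really so when `p.2 ≠ 0`, this forces `c = 0`. -/
theorem eq_zero_of_norm_sub_expTerm_le {h : ℂ → ℂ} {c : ℂ} {p : ℝ × ℝ} {K κ : ℝ}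
    (hd : DifferentiableOn ℂ h {z | 0 < z.re})
    (hb : ∀ z : ℂ, 0 < z.re → ‖h z - c * expTerm p z‖ ≤ K * Real.exp (-(κ * z.re)))
    (hp : p.2 ≠ 0) (hκ : p.1 + p.2 < κ) : c = 0 := by
  set L : ℂ → ℂ := fun z => c * Complex.exp (p.2 * (z - (starRingEnd ℂ) z)) with hL
  have hK : 0 ≤ K := by
    have := (norm_nonneg _).trans (hb 1 (by simp))
    exact nonneg_of_mul_nonneg_left this (Real.exp_pos _)
  have hopen : IsOpen {z : ℂ | 0 < z.re} := isOpen_lt continuous_const Complex.continuous_re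
  have hLd : DifferentiableOn ℂ L {z | 0 < z.re} := by
    refine TendstoUniformlyOn.differentiableOn_of_complex (f := fun (n : ℕ) z =>
      h (z + n) * Complex.exp ((p.1 + p.2) * (z + n))) hopen (fun n => ?_) ?_
    · refine DifferentiableOn.mul ?_ (by fun_prop)
      refine hd.comp (by fun_prop) fun z hz => ?_
      simp only [mem_ofPred_eq, Complex.add_re, Complex.natCast_re] at hz ⊢
      positivity
    · rw [Metric.tendstoUniformlyOn_iff]
      intro ε hε
      have ht : Tendsto (fun n : ℕ => K * Real.exp (-((κ - (p.1 + p.2)) * n))) atTop (𝓝 (K * 0)) := by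
        refine Tendsto.const_mul _ (Real.tendsto_exp_neg_atTop_nhds_zero.comp ?_)
        exact tendsto_natCast_atTop_atTop.const_mul_atTop (by linarith)
      rw [mul_zero] at ht
      filter_upwards [ht.eventually_lt_const hε] with n hn z hz
      replace hz : 0 < z.re := hz
      refine lt_of_le_of_lt ?_ hn
      rw [dist_comm, dist_eq_norm]
      have hz' : 0 < (z + n).re := by simp; positivity
      have e1 : L z = c * expTerm p (z + n) * Complex.exp ((p.1 + p.2) * (z + n)) := by
        rw [hL, expTerm, mul_assoc, ← Complex.exp_add]
        simp only [map_add, map_natCast]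
        ring_nf
      rw [e1, ← sub_mul, norm_mul, Complex.norm_exp]
      calc _ ≤ K * Real.exp (-(κ * (z + n).re)) * Real.exp (((p.1 + p.2) * (z + n)).re) := by
            gcongr
            exact hb _ hz'
        _ = K * Real.exp (-((κ - (p.1 + p.2)) * n)) * Real.exp (-((κ - (p.1 + p.2)) * z.re)) := by
            rw [mul_assoc, mul_assoc, ← Real.exp_add, ← Real.exp_add]
            simp only [Complex.add_re, Complex.mul_re, Complex.ofReal_re, Complex.natCast_re,
              Complex.add_im, Complex.ofReal_im, add_zero, zero_mul, sub_zero]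
            ring_nf
        _ ≤ K * Real.exp (-((κ - (p.1 + p.2)) * n)) * 1 := by
            gcongr
            rw [Real.exp_le_one_iff]
            have := mul_pos (sub_pos.2 hκ) hz
            linarith
        _ = _ := mul_one _
  -- The complex derivative of `L` at `1` is read off twice: the real direction gives `0`, the
  -- imaginary direction gives a nonzero multiple of `c`.
  have h1 : HasDerivAt L (deriv L 1) 1 :=
    (hLd.differentiableAt (hopen.mem_nhds (by simp))).hasDerivAt
  have h2 : HasDerivAt (fun t : ℝ => L (1 + t)) (deriv L 1 * 1) 0 := by
    refine HasDerivAt.comp (𝕜 := ℝ) (𝕜' := ℂ) (0 : ℝ) (h₂ := L) (h := fun t : ℝ => 1 + (t : ℂ)) (by simpa using h1) ?_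
    simpa using (Complex.ofRealCLM.hasDerivAt (x := 0)).const_add (1 : ℂ)
  have h3 : HasDerivAt (fun t : ℝ => L (1 + t * Complex.I)) (deriv L 1 * Complex.I) 0 := by
    refine HasDerivAt.comp (𝕜 := ℝ) (𝕜' := ℂ) (0 : ℝ) (h₂ := L) (h := fun t : ℝ => 1 + (t : ℂ) * Complex.I) (by simpa using h1) ?_
    simpa using ((Complex.ofRealCLM.hasDerivAt (x := 0)).mul_const Complex.I).const_add (1 : ℂ)
  have h2' : HasDerivAt (fun t : ℝ => L (1 + t)) 0 0 := by
    have : (fun t : ℝ => L (1 + t)) = fun _ => c := by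
      funext t
      simp [hL]
    rw [this]
    exact hasDerivAt_const _ _
  have hz := h2.unique h2'
  rw [mul_one] at hz
  have h3' : HasDerivAt (fun t : ℝ => L (1 + t * Complex.I)) (c * (2 * p.2 * Complex.I)) 0 := by
    have : (fun t : ℝ => L (1 + t * Complex.I))
        = fun t : ℝ => c * Complex.exp (2 * p.2 * Complex.I * t) := by
      funext t
      simp only [hL, map_add, map_one, map_mul, Complex.conj_ofReal, Complex.conj_I]
      ring_nf
    rw [this]
    have := ((Complex.ofRealCLM.hasDerivAt (x := 0)).const_mul (2 * p.2 * Complex.I)).cexp.const_mul c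
    simpa using this
  have := h3.unique h3'
  rw [hz, zero_mul] at this
  have hp' : (p.2 : ℂ) ≠ 0 := by exact_mod_cast hp
  simpa [hp', Complex.I_ne_zero] using this

/-- Since the exponentials are characters, `g (z + a) - expTerm q a * g z` has no `q` term, while
its `p` coefficient is multiplied by `expTerm p a - expTerm q a ≠ 0`. This removes the other
exponents one by one. -/
theorem coeff_eq_zero_of_norm_sub_sum_le (S : Finset (ℝ × ℝ)) :
    ∀ {g : ℂ → ℂ} {b : ℝ × ℝ → ℂ} {c : ℂ} {p : ℝ × ℝ} {K κ : ℝ}, p ∉ S →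
    DifferentiableOn ℂ g {z | 0 < z.re} →
    (∀ z : ℂ, 0 < z.re → ‖g z - c * expTerm p z - ∑ q ∈ S, b q * expTerm q z‖
      ≤ K * Real.exp (-(κ * z.re))) →
    p.2 ≠ 0 → p.1 + p.2 < κ → c = 0 := by
  induction S using Finset.induction_on with
  | empty =>
    intro g b c p K κ _ hd hb hp hκ
    exact eq_zero_of_norm_sub_expTerm_le hd (by simpa using hb) hp hκ
  | insert q S hq ih =>
    intro g b c p K κ hpS hd hb hp hκ
    rw [Finset.mem_insert, not_or] at hpS
    obtain ⟨a, ha, hne⟩ := exists_expTerm_ne hpS.1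
    have key : c * (expTerm p a - expTerm q a) = 0 := by
      refine ih (g := fun z => g (z + a) - expTerm q a * g z)
        (b := fun r => b r * (expTerm r a - expTerm q a))
        (K := K * (Real.exp (-(κ * a.re)) + ‖expTerm q a‖)) (κ := κ) hpS.2 ?_ ?_ hp hκ
      · refine DifferentiableOn.sub ?_ (hd.const_mul _)
        refine hd.comp (by fun_prop) fun z hz => ?_
        simp only [mem_ofPred_eq, Complex.add_re] at hz ⊢
        linarith
      · intro z hz
        have hza : 0 < (z + a).re := by rw [Complex.add_re]; linarith
        have e : g (z + a) - expTerm q a * g z - c * (expTerm p a - expTerm q a) * expTerm p z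
            - ∑ r ∈ S, b r * (expTerm r a - expTerm q a) * expTerm r z
            = (g (z + a) - c * expTerm p (z + a) - ∑ r ∈ insert q S, b r * expTerm r (z + a))
              - expTerm q a * (g z - c * expTerm p z - ∑ r ∈ insert q S, b r * expTerm r z) := by
          rw [Finset.sum_insert hq, Finset.sum_insert hq]
          have : ∑ r ∈ S, b r * (expTerm r a - expTerm q a) * expTerm r z
              = ∑ r ∈ S, b r * expTerm r (z + a) - expTerm q a * ∑ r ∈ S, b r * expTerm r z := by
            rw [Finset.mul_sum, ← Finset.sum_sub_distrib]
            refine Finset.sum_congr rfl fun r _ => ?_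
            rw [expTerm_add]
            ring
          rw [this, expTerm_add, expTerm_add]
          ring
        rw [e]
        refine (norm_sub_le _ _).trans ?_
        rw [norm_mul]
        calc _ ≤ K * Real.exp (-(κ * (z + a).re))
              + ‖expTerm q a‖ * (K * Real.exp (-(κ * z.re))) := by
              gcongr
              · exact hb _ hza
              · exact hb _ hz
          _ = _ := by
              rw [Complex.add_re, mul_add, neg_add, Real.exp_add]
              ring
    exact (mul_eq_zero.1 key).resolve_right (sub_ne_zero.2 hne)

theorem norm_le_of_bounded_of_norm_imag_axis_le {h : ℂ → ℂ} {B C : ℝ}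
    (hd : DiffContOnCl ℂ h {z | 0 < z.re}) (hB : ∀ z : ℂ, 0 ≤ z.re → ‖h z‖ ≤ B)
    (hC : ∀ z : ℂ, z.re = 0 → ‖h z‖ ≤ C) {z : ℂ} (hz : 0 ≤ z.re) : ‖h z‖ ≤ C := by
  refine PhragmenLindelof.right_half_plane_of_bounded_on_real hd ⟨1, by norm_num, 0, ?_⟩ ?_
    (fun x => hC _ (by simp)) hz
  · refine Asymptotics.IsBigO.of_bound B ?_
    refine Filter.eventually_inf_principal.2 (Eventually.of_forall fun z hz => ?_)
    simpa using hB z (le_of_lt hz)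
  · exact ⟨B, eventually_map.2 ((eventually_ge_atTop 0).mono fun x hx => hB _ (by simpa using hx))⟩

/-- The function `exp (t z) g z` is bounded, and at most `C` on the imaginary axis, hence at most
`C` throughout by Phragmén–Lindelöf; along the positive real axis it tends to `c`. -/
theorem norm_le_of_norm_sub_expTerm_le {g : ℂ → ℂ} {c : ℂ} {t K κ C : ℝ}
    (hd : DiffContOnCl ℂ g {z | 0 < z.re})
    (hC : ∀ z : ℂ, 0 ≤ z.re → ‖g z‖ ≤ C)
    (hb : ∀ z : ℂ, 0 ≤ z.re → ‖g z - c * expTerm (t, 0) z‖ ≤ K * Real.exp (-(κ * z.re)))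
    (hκ : t < κ) : ‖c‖ ≤ C := by
  have hK : 0 ≤ K := by
    have := (norm_nonneg _).trans (hb 0 (by simp))
    exact nonneg_of_mul_nonneg_left this (Real.exp_pos _)
  set h : ℂ → ℂ := fun z => Complex.exp (t * z) * g z with hh
  have hdiff : ∀ z : ℂ, 0 ≤ z.re → ‖h z - c‖ ≤ K * Real.exp (-((κ - t) * z.re)) := by
    intro z hz
    have : h z - c = Complex.exp (t * z) * (g z - c * expTerm (t, 0) z) := by
      rw [hh, expTerm_fst_zero, mul_sub, mul_left_comm, ← Complex.exp_add]
      simp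
    rw [this, norm_mul, Complex.norm_exp]
    calc _ ≤ Real.exp (((t : ℂ) * z).re) * (K * Real.exp (-(κ * z.re))) := by
          gcongr
          exact hb z hz
      _ = _ := by
          rw [mul_left_comm, ← Real.exp_add]
          simp
          ring_nf
          simp
  have hhC : ∀ z : ℂ, 0 ≤ z.re → ‖h z‖ ≤ C := by
    intro z hz
    refine norm_le_of_bounded_of_norm_imag_axis_le (B := ‖c‖ + K) ?_ (fun z hz => ?_)
      (fun z hz => ?_) hz
    · exact (Differentiable.diffContOnCl (f := fun z : ℂ => Complex.exp (t * z))
        (by fun_prop)).smul hd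
    · calc ‖h z‖ ≤ ‖c‖ + ‖h z - c‖ := norm_le_insert' _ _
        _ ≤ ‖c‖ + K * 1 := by
          gcongr
          refine (hdiff z hz).trans ?_
          gcongr
          rw [Real.exp_le_one_iff]
          have := mul_nonneg (sub_pos.2 hκ).le hz
          linarith
        _ = _ := by rw [mul_one]
    · rw [hh, norm_mul, Complex.norm_exp]
      simpa [hz] using hC z hz.ge
  have ht : Tendsto (fun n : ℕ => h n) atTop (𝓝 c) := by
    rw [tendsto_iff_norm_sub_tendsto_zero]
    have ht : Tendsto (fun n : ℕ => K * Real.exp (-((κ - t) * n))) atTop (𝓝 (K * 0)) := by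
      refine Tendsto.const_mul _ (Real.tendsto_exp_neg_atTop_nhds_zero.comp ?_)
      exact tendsto_natCast_atTop_atTop.const_mul_atTop (by linarith)
    rw [mul_zero] at ht
    refine squeeze_zero (fun _ => norm_nonneg _) (fun n => ?_) ht
    simpa using hdiff n (by simp)
  exact le_of_tendsto ht.norm (Eventually.of_forall fun n => hhC n (by simp))

/-- Here a term is removed by averaging `g` with a unimodular multiple of an imaginary translate of
`g`. An average keeps the bound `C`, which the differences used for vanishing coefficients would
not. -/
theorem coeff_norm_le_of_norm_sub_sum_le (S : Finset ℝ) :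
    ∀ {g : ℂ → ℂ} {b : ℝ → ℂ} {c : ℂ} {t K κ C : ℝ}, t ∉ S →
    DiffContOnCl ℂ g {z | 0 < z.re} →
    (∀ z : ℂ, 0 ≤ z.re → ‖g z‖ ≤ C) →
    (∀ z : ℂ, 0 ≤ z.re → ‖g z - c * expTerm (t, 0) z - ∑ q ∈ S, b q * expTerm (q, 0) z‖
      ≤ K * Real.exp (-(κ * z.re))) → t < κ → ‖c‖ ≤ C := by
  induction S using Finset.induction_on with
  | empty =>
    intro g b c t K κ C _ hd hC hb hκ
    exact norm_le_of_norm_sub_expTerm_le hd hC (by simpa using hb) hκ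
  | insert q S hq ih =>
    intro g b c t K κ C htS hd hC hb hκ
    rw [Finset.mem_insert, not_or] at htS
    have hne : q - t ≠ 0 := sub_ne_zero.2 (Ne.symm htS.1)
    -- Over the imaginary step `a` the characters of `q` and `t` acquire opposite signs; dividing by
    -- that of `t` fixes the coefficient `c` and cancels the `q` term.
    set a : ℂ := (Real.pi / (q - t) : ℝ) * Complex.I with ha
    have hare : a.re = 0 := by rw [ha, Complex.re_ofReal_mul]; simp
    set e : ℂ := (expTerm (t, 0) a)⁻¹ with he
    have he0 : e * expTerm (t, 0) a = 1 := inv_mul_cancel₀ (expTerm_ne_zero _ _)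
    have he1 : e * expTerm (q, 0) a = -1 := by
      have := expTerm_pi_div_mul_I (p := (q, 0)) (q := (t, 0)) (by simpa using hne)
      simp only [sub_zero] at this
      rw [ha, this, ← ha, mul_neg, he0]
    have hen : ‖e‖ = 1 := by
      rw [he, norm_inv, norm_expTerm, hare]
      simp
    have hza : ∀ z : ℂ, (z + a).re = z.re := fun z => by rw [Complex.add_re, hare, add_zero]
    refine ih (g := fun z => (1 / 2 : ℂ) * (e * g (z + a) + g z))
      (b := fun r => (1 / 2 : ℂ) * (b r * (e * expTerm (r, 0) a + 1)))
      (K := K) (κ := κ) htS.2 ?_ ?_ ?_ hκ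
    · have h1 : DiffContOnCl ℂ (fun z => g (z + a)) {z | 0 < z.re} :=
        hd.comp (Differentiable.diffContOnCl (by fun_prop)) fun z hz => by
          simpa only [mem_ofPred_eq, hza] using hz
      exact ((h1.const_smul e).add hd).const_smul (1 / 2 : ℂ)
    · intro z hz
      rw [norm_mul]
      calc _ ≤ ‖(1 / 2 : ℂ)‖ * (‖e‖ * ‖g (z + a)‖ + ‖g z‖) := by
            gcongr
            exact (norm_add_le _ _).trans (by rw [norm_mul])
        _ ≤ ‖(1 / 2 : ℂ)‖ * (1 * C + C) := by
            rw [hen]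
            gcongr
            · exact hC _ (by rwa [hza])
            · exact hC _ hz
        _ = C := by simp; ring
    · intro z hz
      have e' : (1 / 2 : ℂ) * (e * g (z + a) + g z) - c * expTerm (t, 0) z
          - ∑ r ∈ S, (1 / 2 : ℂ) * (b r * (e * expTerm (r, 0) a + 1)) * expTerm (r, 0) z
          = (1 / 2 : ℂ) * (e * (g (z + a) - c * expTerm (t, 0) (z + a)
              - ∑ r ∈ insert q S, b r * expTerm (r, 0) (z + a))
            + (g z - c * expTerm (t, 0) z - ∑ r ∈ insert q S, b r * expTerm (r, 0) z)) := by
        rw [Finset.sum_insert hq, Finset.sum_insert hq]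
        have : ∑ r ∈ S, (1 / 2 : ℂ) * (b r * (e * expTerm (r, 0) a + 1)) * expTerm (r, 0) z
            = (1 / 2 : ℂ) * (e * ∑ r ∈ S, b r * expTerm (r, 0) (z + a)
              + ∑ r ∈ S, b r * expTerm (r, 0) z) := by
          rw [Finset.mul_sum, ← Finset.sum_add_distrib, Finset.mul_sum]
          refine Finset.sum_congr rfl fun r _ => ?_
          rw [expTerm_add]
          ring
        rw [this, expTerm_add, expTerm_add]
        linear_combination (1 / 2 * c * expTerm (t, 0) z) * he0
          + (1 / 2 * b q * expTerm (q, 0) z) * he1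
      rw [e', norm_mul]
      calc _ ≤ ‖(1 / 2 : ℂ)‖ * (‖e‖ * (K * Real.exp (-(κ * (z + a).re)))
            + K * Real.exp (-(κ * z.re))) := by
            gcongr
            refine (norm_add_le _ _).trans ?_
            rw [norm_mul]
            gcongr
            · exact hb _ (by rwa [hza])
            · exact hb _ hz
        _ = _ := by
            rw [hen, hza]
            simp
            ring

/-- If a bounded holomorphic function on the right half plane agrees up to `O(exp (-κ Re z))` with
a finite sum of exponentials `b exp (-(λ z + μ z̄))`, then it agrees with the holomorphic part of
that sum, with an explicit bound for the error. -/
theorem norm_sub_sum_le_of_norm_sub_sum_expTerm_le {g : ℂ → ℂ} {C K κ : ℝ} (S : Finset (ℝ × ℝ))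
    (b : ℝ × ℝ → ℂ)
    (hd : DiffContOnCl ℂ g {z | 0 < z.re})
    (hC : ∀ z : ℂ, 0 ≤ z.re → ‖g z‖ ≤ C)
    (hb : ∀ z : ℂ, 0 ≤ z.re → ‖g z - ∑ p ∈ S, b p * expTerm p z‖ ≤ K * Real.exp (-(κ * z.re)))
    {z : ℂ} (hz : 0 ≤ z.re) :
    ‖g z - ∑ p ∈ S with p.2 = 0 ∧ p.1 < κ, b p * expTerm p z‖
      ≤ C * (1 + (S.filter fun p => p.2 = 0 ∧ p.1 < κ).card) * Real.exp (-(κ * z.re)) := by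
  set H := S.filter fun p => p.2 = 0 ∧ p.1 < κ with hH
  have hC0 : 0 ≤ C := (norm_nonneg _).trans (hC 0 (by simp))
  have hzero : ∀ p ∈ S, p.2 ≠ 0 → p.1 + p.2 < κ → b p = 0 := by
    intro p hp hp2 hpκ
    refine coeff_eq_zero_of_norm_sub_sum_le (S.erase p) (g := g) (b := b) (K := K)
      (Finset.notMem_erase p S) hd.differentiableOn (fun z hz => ?_) hp2 hpκ
    rw [sub_sub, Finset.add_sum_erase S (fun q => b q * expTerm q z) hp]
    exact hb z (le_of_lt hz)
  -- Terms of total weight at least `κ` are no larger than the error and move into its constant. The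
  -- size of `K'` is irrelevant: it only provides the boundedness that Phragmén–Lindelöf requires.
  set K' := K + ∑ p ∈ S \ H, ‖b p‖ with hK'
  have hbH : ∀ z : ℂ, 0 ≤ z.re →
      ‖g z - ∑ p ∈ H, b p * expTerm p z‖ ≤ K' * Real.exp (-(κ * z.re)) := by
    intro z hz
    have e : g z - ∑ p ∈ H, b p * expTerm p z
        = (g z - ∑ p ∈ S, b p * expTerm p z) + ∑ p ∈ S \ H, b p * expTerm p z := by
      rw [← Finset.sum_sdiff (Finset.filter_subset _ S : H ⊆ S)]
      ring
    rw [e, hK', add_mul, Finset.sum_mul]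
    refine (norm_add_le _ _).trans (add_le_add (hb z hz) ?_)
    refine norm_sum_le_of_le _ fun p hp => ?_
    rw [Finset.mem_sdiff, hH, Finset.mem_filter, not_and, not_and] at hp
    by_cases hpκ : p.1 + p.2 < κ
    · have hp2 : p.2 ≠ 0 := fun h0 => hp.2 hp.1 h0 (by simpa [h0] using hpκ)
      rw [hzero p hp.1 hp2 hpκ]
      simp
    · rw [norm_mul, norm_expTerm]
      gcongr
      linarith
  have hcoeff : ∀ p ∈ H, ‖b p‖ ≤ C := by
    intro p hp
    have hp' := (Finset.mem_filter.1 hp).2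
    have hinj : Set.InjOn Prod.fst (H : Set (ℝ × ℝ)) := by
      intro q hq r hr hqr
      have hq' := (Finset.mem_filter.1 (Finset.mem_coe.1 hq)).2.1
      have hr' := (Finset.mem_filter.1 (Finset.mem_coe.1 hr)).2.1
      exact Prod.ext hqr (hq'.trans hr'.symm)
    have hfst : ∀ q ∈ H, (q.1, (0 : ℝ)) = q := fun q hq =>
      Prod.ext rfl (Finset.mem_filter.1 hq).2.1.symm
    refine coeff_norm_le_of_norm_sub_sum_le ((H.erase p).image Prod.fst) (g := g)
      (b := fun t => b (t, 0)) (t := p.1) (K := K') (κ := κ) ?_ hd hC (fun z hz => ?_) hp'.2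
    · rw [Finset.mem_image]
      rintro ⟨q, hq, hqp⟩
      exact Finset.ne_of_mem_erase hq (hinj (Finset.mem_of_mem_erase hq) hp hqp)
    · rw [Finset.sum_image fun q hq r hr h => hinj (Finset.mem_of_mem_erase hq)
        (Finset.mem_of_mem_erase hr) h]
      rw [Finset.sum_congr rfl fun q hq => by rw [hfst q (Finset.mem_of_mem_erase hq)], hfst p hp,
        sub_sub, Finset.add_sum_erase H (fun q => b q * expTerm q z) hp]
      exact hbH z hz
  -- On the imaginary axis every exponential has modulus one, so there `h` is bounded in terms of
  -- `C` and the number of terms alone.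
  set h : ℂ → ℂ := fun z => Complex.exp (κ * z) * (g z - ∑ p ∈ H, b p * expTerm p z) with hh
  have hnorm : ∀ z : ℂ, ‖h z‖ = Real.exp (κ * z.re) * ‖g z - ∑ p ∈ H, b p * expTerm p z‖ := by
    intro z
    rw [hh, norm_mul, Complex.norm_exp]
    simp
  have hsum : DiffContOnCl ℂ (fun z => ∑ p ∈ H, b p * expTerm p z) {z | 0 < z.re} := by
    refine Differentiable.diffContOnCl (Differentiable.fun_sum fun p hp => ?_)
    have : expTerm p = fun z => Complex.exp (-(p.1 * z)) := by
      funext z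
      rw [expTerm, (Finset.mem_filter.1 hp).2.1]
      simp
    rw [this]
    fun_prop
  have hle : ‖h z‖ ≤ C * (1 + H.card) := by
    refine norm_le_of_bounded_of_norm_imag_axis_le (B := K') ?_ (fun z hz => ?_)
      (fun z hz => ?_) hz
    · exact (Differentiable.diffContOnCl (f := fun z : ℂ => Complex.exp (κ * z))
        (by fun_prop)).smul (hd.sub hsum)
    · rw [hnorm]
      calc _ ≤ Real.exp (κ * z.re) * (K' * Real.exp (-(κ * z.re))) := by
            gcongr
            exact hbH z hz
        _ = K' := by rw [mul_left_comm, ← Real.exp_add, add_neg_cancel, Real.exp_zero, mul_one]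
    · rw [hnorm, hz, mul_zero, Real.exp_zero, one_mul, mul_add, mul_one, mul_comm C (H.card : ℝ)]
      refine (norm_sub_le _ _).trans (add_le_add (hC z hz.ge) ?_)
      rw [← nsmul_eq_mul, ← Finset.sum_const]
      refine norm_sum_le_of_le _ fun p hp => ?_
      rw [norm_mul, norm_expTerm, hz]
      simpa using hcoeff p hp
  rw [hnorm] at hle
  calc _ = Real.exp (κ * z.re) * ‖g z - ∑ p ∈ H, b p * expTerm p z‖ * Real.exp (-(κ * z.re)) := by
        rw [mul_right_comm, ← Real.exp_add, add_neg_cancel, Real.exp_zero, one_mul]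
    _ ≤ _ := by gcongr

/-! ### Holomorphy at the centre of a diagonal linear flow -/

/-- Evaluation of a polynomial in `w` and `w̄`. -/
noncomputable def evalConj {N : ℕ} (p : MvPolynomial (Fin N ⊕ Fin N) ℂ) (w : Fin N → ℂ) : ℂ :=
  MvPolynomial.eval (Sum.elim w fun i => (starRingEnd ℂ) (w i)) p

theorem continuous_evalConj {N : ℕ} (p : MvPolynomial (Fin N ⊕ Fin N) ℂ) :
    Continuous (evalConj p) := by
  refine (MvPolynomial.continuous_eval p).comp (continuous_pi fun i => ?_)
  rcases i with i | i
  · exact continuous_apply i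
  · exact Complex.continuous_conj.comp (continuous_apply i)

/-- `f` agrees up to `o(|w|^n)` with polynomials in `w` and `w̄`, for every `n`. -/
def HasPolynomialApprox {N : ℕ} (n : ℕ) (f : (Fin N → ℂ) → ℂ) : Prop :=
  ∃ p : MvPolynomial (Fin N ⊕ Fin N) ℂ,
    (fun w => f w - evalConj p w) =o[𝓝 0] fun w : Fin N → ℂ => ‖w‖ ^ n

/-- The linear flow `ζ ↦ (exp (-(r_j ζ)) w_j)_j`. -/
noncomputable def diagFlow {N : ℕ} (r : Fin N → ℝ) (ζ : ℂ) (w : Fin N → ℂ) : Fin N → ℂ :=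
  fun j => Complex.exp (-(r j * ζ)) * w j

theorem norm_diagFlow_le {N : ℕ} {r : Fin N → ℝ} {ρ : ℝ} (hr : ∀ j, ρ ≤ r j) {ζ : ℂ}
    (hζ : 0 ≤ ζ.re) (w : Fin N → ℂ) : ‖diagFlow r ζ w‖ ≤ Real.exp (-(ρ * ζ.re)) * ‖w‖ := by
  refine (pi_norm_le_iff_of_nonneg (by positivity)).2 fun j => ?_
  rw [diagFlow, norm_mul, Complex.norm_exp]
  gcongr
  · simpa using mul_le_mul_of_nonneg_right (hr j) hζ
  · exact norm_le_pi_norm w j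

/-- The pair of weights of the monomial `w^k w̄^m`. -/
noncomputable def bidegree {N : ℕ} (r : Fin N → ℝ) (d : Fin N ⊕ Fin N →₀ ℕ) : ℝ × ℝ :=
  (∑ j, r j * d (Sum.inl j), ∑ j, r j * d (Sum.inr j))

/-- The monomial `w^k w̄^m` of exponent `(k, m) = d`. -/
noncomputable def monomConj {N : ℕ} (d : Fin N ⊕ Fin N →₀ ℕ) (w : Fin N → ℂ) : ℂ :=
  (∏ j, w j ^ d (Sum.inl j)) * ∏ j, (starRingEnd ℂ) (w j) ^ d (Sum.inr j)

theorem evalConj_eq_sum {N : ℕ} (p : MvPolynomial (Fin N ⊕ Fin N) ℂ) (w : Fin N → ℂ) :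
    evalConj p w = ∑ d ∈ p.support, p.coeff d * monomConj d w := by
  rw [evalConj, MvPolynomial.eval_eq']
  simp [monomConj, Fintype.prod_sum_type]

theorem monomConj_diagFlow {N : ℕ} (r : Fin N → ℝ) (d : Fin N ⊕ Fin N →₀ ℕ) (ζ : ℂ)
    (w : Fin N → ℂ) :
    monomConj d (diagFlow r ζ w) = monomConj d w * expTerm (bidegree r d) ζ := by
  simp only [monomConj, diagFlow, bidegree, expTerm, mul_pow, Finset.prod_mul_distrib, map_mul,
    ← Complex.exp_conj, map_neg, Complex.conj_ofReal, ← Complex.exp_nat_mul, ← Complex.exp_sum]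
  rw [neg_add, Complex.exp_add]
  push_cast
  have h1 : ∀ (x : ℂ) (s : Fin N → ℕ), ∑ j, (s j : ℂ) * -(r j * x) = -((∑ j, r j * s j : ℂ) * x) := by
    intro x s
    rw [Finset.sum_mul, ← Finset.sum_neg_distrib]
    exact Finset.sum_congr rfl fun j _ => by ring
  rw [h1, h1]
  ring

/-- The weights are positive, so zero conjugate weight means that no `w̄` occurs. -/
theorem differentiable_monomConj_of_bidegree_snd {N : ℕ} {r : Fin N → ℝ} (hr : ∀ j, 0 < r j)
    {d : Fin N ⊕ Fin N →₀ ℕ} (hd : (bidegree r d).2 = 0) : Differentiable ℂ (monomConj d) := by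
  have h0 : ∀ j, d (Sum.inr j) = 0 := by
    intro j
    have := (Finset.sum_eq_zero_iff_of_nonneg (s := Finset.univ) (f := fun j => r j * (d (Sum.inr j) : ℝ))
      fun i _ => mul_nonneg (hr i).le (Nat.cast_nonneg _)).1 hd j (Finset.mem_univ j)
    simpa [(hr j).ne'] using this
  have : monomConj d = fun w => ∏ j, w j ^ d (Sum.inl j) := by
    funext w
    simp [monomConj, h0]
  rw [this]
  fun_prop

/-- The little-o bound serves near `0`; away from `0` both functions are bounded and `‖w‖` is
bounded below. -/
theorem exists_norm_sub_evalConj_le {N : ℕ} {f : (Fin N → ℂ) → ℂ} {n : ℕ} {ε C : ℝ}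
    (hC : ∀ w ∈ ball 0 ε, ‖f w‖ ≤ C) {p : MvPolynomial (Fin N ⊕ Fin N) ℂ}
    (hp : (fun w => f w - evalConj p w) =o[𝓝 0] fun w : Fin N → ℂ => ‖w‖ ^ n) :
    ∃ K, 0 ≤ K ∧ ∀ w ∈ ball 0 ε, ‖f w - evalConj p w‖ ≤ K * ‖w‖ ^ n := by
  obtain ⟨δ, hδ, hδp⟩ := Metric.eventually_nhds_iff_ball.1 (hp.bound one_pos)
  obtain ⟨B, hB⟩ := (isCompact_closedBall (0 : Fin N → ℂ) ε).exists_bound_of_continuousOn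
    (continuous_evalConj p).continuousOn
  refine ⟨max 1 ((C + B) / δ ^ n), le_max_of_le_left zero_le_one, fun w hw => ?_⟩
  by_cases hwδ : w ∈ ball 0 δ
  · refine (hδp w hwδ).trans ?_
    rw [norm_pow, norm_norm]
    gcongr
    exact le_max_left _ _
  · have hle : δ ≤ ‖w‖ := by simpa using hwδ
    have hCB : ‖f w - evalConj p w‖ ≤ C + B :=
      (norm_sub_le _ _).trans (add_le_add (hC w hw) (hB w (ball_subset_closedBall hw)))
    have hCB0 : 0 ≤ C + B := (norm_nonneg _).trans hCB
    calc _ ≤ C + B := hCB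
      _ = (C + B) / δ ^ n * δ ^ n := by field_simp
      _ ≤ max 1 ((C + B) / δ ^ n) * ‖w‖ ^ n := by
        gcongr
        exact le_max_right _ _

/-- Along the flow the polynomial becomes an exponential sum whose coefficients depend on `w`
through monomials. Only those without `w̄` survive, so the approximant is holomorphic in `w`, and
the error bound does not see the remainder constant `K`. -/
theorem exists_differentiable_approx {N : ℕ} {f : (Fin N → ℂ) → ℂ} {r : Fin N → ℝ}
    {ε C ρ : ℝ} (hρ : 0 < ρ) (hr : ∀ j, ρ ≤ r j)
    (hC : ∀ w ∈ ball 0 ε, ‖f w‖ ≤ C)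
    (hflow : ∀ w ∈ ball 0 ε, DifferentiableOn ℂ (fun ζ => f (diagFlow r ζ w))
      {ζ | diagFlow r ζ w ∈ ball 0 ε}) {n : ℕ} (hT : HasPolynomialApprox n f) :
    ∃ Q : (Fin N → ℂ) → ℂ, Differentiable ℂ Q ∧ ∀ w ∈ ball 0 ε,
      ‖f (diagFlow r 1 w) - Q w‖ ≤ C * (1 + (n + 1) ^ N) * Real.exp (-(n * ρ)) := by
  obtain ⟨p, hp⟩ := hT
  obtain ⟨K, hK, hKp⟩ := exists_norm_sub_evalConj_le hC hp
  have hr0 : ∀ j, 0 < r j := fun j => hρ.trans_le (hr j)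
  set S := p.support.image (bidegree r) with hS
  -- Resonant monomials share a bidegree and cannot be separated along the flow, so they are grouped
  -- into one coefficient.
  set b : (Fin N → ℂ) → ℝ × ℝ → ℂ := fun w q =>
    ∑ d ∈ p.support with bidegree r d = q, p.coeff d * monomConj d w with hb
  set H := S.filter fun q => q.2 = 0 ∧ q.1 < n * ρ with hH
  -- As `r j ≥ ρ`, a weight `∑ r_j k_j < nρ` forces every `k_j < n`.
  have hcard : (H.card : ℝ) ≤ (n + 1) ^ N := by
    have hsub : H ⊆ (Fintype.piFinset fun _ : Fin N => Finset.range (n + 1)).image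
        fun k => (∑ j, r j * k j, (0 : ℝ)) := by
      intro q hq
      rw [hH, Finset.mem_filter, hS, Finset.mem_image] at hq
      obtain ⟨⟨d, -, rfl⟩, h2, h1⟩ := hq
      refine Finset.mem_image.2 ⟨fun j => d (Sum.inl j), ?_, Prod.ext rfl h2.symm⟩
      rw [Fintype.mem_piFinset]
      intro j
      rw [Finset.mem_range]
      have hj : r j * d (Sum.inl j) ≤ (bidegree r d).1 :=
        Finset.single_le_sum (f := fun j => r j * (d (Sum.inl j) : ℝ))
          (fun i _ => mul_nonneg (hr0 i).le (Nat.cast_nonneg _)) (Finset.mem_univ j)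
      have hj' : ρ * d (Sum.inl j) ≤ r j * d (Sum.inl j) := by
        gcongr
        exact hr j
      have : (d (Sum.inl j) : ℝ) < n := by
        refine lt_of_mul_lt_mul_left (a := ρ) ?_ hρ.le
        linarith [mul_comm (n : ℝ) ρ]
      have : d (Sum.inl j) < n := by exact_mod_cast this
      omega
    have := (Finset.card_le_card hsub).trans Finset.card_image_le
    rw [Fintype.card_piFinset_const, Finset.card_range] at this
    exact_mod_cast this
  refine ⟨fun w => ∑ q ∈ H, b w q * expTerm q 1, ?_, fun w hw => ?_⟩
  · refine Differentiable.fun_sum fun q hq => Differentiable.mul_const ?_ _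
    refine Differentiable.fun_sum fun d hd => Differentiable.const_mul ?_ _
    refine differentiable_monomConj_of_bidegree_snd hr0 ?_
    rw [(Finset.mem_filter.1 hd).2]
    exact (Finset.mem_filter.1 hq).2.1
  · have hC0 : 0 ≤ C := (norm_nonneg _).trans (hC w hw)
    have hmem : ∀ ζ : ℂ, 0 ≤ ζ.re → diagFlow r ζ w ∈ ball 0 ε := by
      intro ζ hζ
      rw [mem_ball_zero_iff] at hw ⊢
      refine (norm_diagFlow_le (fun j => (hr0 j).le) hζ w).trans_lt ?_
      simpa using hw
    have hcl : closure {z : ℂ | 0 < z.re} = {z | 0 ≤ z.re} := Complex.closure_setOfPred_lt_re 0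
    have key := norm_sub_sum_le_of_norm_sub_sum_expTerm_le (g := fun ζ => f (diagFlow r ζ w))
      (C := C) (K := K * ‖w‖ ^ n) (κ := n * ρ) S (b w) ?_ (fun z hz => hC _ (hmem z hz))
      (fun z hz => ?_) (z := 1) (by simp)
    · refine key.trans ?_
      simp only [Complex.one_re, mul_one]
      gcongr
    · refine DifferentiableOn.diffContOnCl ?_
      rw [hcl]
      exact (hflow w hw).mono fun z hz => hmem z hz
    · have e : ∑ q ∈ S, b w q * expTerm q z = evalConj p (diagFlow r z w) := by
        rw [evalConj_eq_sum, ← Finset.sum_fiberwise_of_maps_to (g := bidegree r) (t := S)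
          (fun d hd => Finset.mem_image_of_mem _ hd)]
        refine Finset.sum_congr rfl fun q _ => ?_
        rw [hb, Finset.sum_mul]
        refine Finset.sum_congr rfl fun d hd => ?_
        rw [monomConj_diagFlow, (Finset.mem_filter.1 hd).2, mul_assoc]
      rw [e]
      refine (hKp _ (hmem z hz)).trans ?_
      rw [mul_assoc]
      gcongr
      calc ‖diagFlow r z w‖ ^ n ≤ (Real.exp (-(ρ * z.re)) * ‖w‖) ^ n := by
            gcongr
            exact norm_diagFlow_le hr hz w
        _ = _ := by
            rw [mul_pow, ← Real.exp_nat_mul, mul_comm]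
            ring_nf

theorem diagFlow_one_neg_one {N : ℕ} (r : Fin N → ℝ) (w : Fin N → ℂ) :
    diagFlow r 1 (diagFlow r (-1) w) = w := by
  funext j
  simp only [diagFlow]
  rw [← mul_assoc, ← Complex.exp_add]
  simp

/-- The exponential factor beats the polynomial count, so `f` composed with the time-one flow is a
uniform limit of holomorphic functions; the flow at time `-1` brings this back to `f` near `0`. -/
theorem exists_differentiableOn_ball_of_diagFlow {N : ℕ} {f : (Fin N → ℂ) → ℂ} {r : Fin N → ℝ}
    {ε C ρ : ℝ} (hε : 0 < ε) (hρ : 0 < ρ) (hr : ∀ j, ρ ≤ r j)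
    (hC : ∀ w ∈ ball 0 ε, ‖f w‖ ≤ C)
    (hflow : ∀ w ∈ ball 0 ε, DifferentiableOn ℂ (fun ζ => f (diagFlow r ζ w))
      {ζ | diagFlow r ζ w ∈ ball 0 ε}) (hT : ∀ n, HasPolynomialApprox n f) :
    ∃ δ > 0, DifferentiableOn ℂ f (ball 0 δ) := by
  choose Q hQd hQ using fun n => exists_differentiable_approx hρ hr hC hflow (hT n)
  have hlim : Tendsto (fun n : ℕ => C * (1 + ((n : ℝ) + 1) ^ N) * Real.exp (-(n * ρ)))
      atTop (𝓝 0) := by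
    have hexp : Real.exp (-ρ) < 1 := by rw [Real.exp_lt_one_iff]; linarith
    have habs : |Real.exp (-ρ)| < 1 := by rwa [abs_of_pos (Real.exp_pos _)]
    have h1 := (tendsto_pow_const_mul_const_pow_of_abs_lt_one N habs).comp (tendsto_add_atTop_nat 1)
    have h2 := tendsto_pow_atTop_nhds_zero_of_abs_lt_one habs
    have h3 := (h2.const_mul C).add (h1.const_mul (C * Real.exp ρ))
    simp only [mul_zero, add_zero] at h3
    refine h3.congr fun n => ?_
    have : Real.exp (-(n * ρ)) = Real.exp (-ρ) ^ n := by
      rw [← Real.exp_nat_mul]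
      ring_nf
    have h5 : Real.exp ρ * Real.exp (-ρ) = 1 := by rw [← Real.exp_add]; simp
    rw [this]
    simp only [Function.comp_apply]
    push_cast
    rw [pow_succ (Real.exp (-ρ)) n]
    linear_combination (C * (n + 1) ^ N * Real.exp (-ρ) ^ n) * h5
  have hunif : TendstoUniformlyOn Q (fun w => f (diagFlow r 1 w)) atTop (ball 0 ε) := by
    rw [Metric.tendstoUniformlyOn_iff]
    intro η hη
    filter_upwards [hlim.eventually_lt_const hη] with n hn w hw
    rw [dist_eq_norm]
    exact (hQ n w hw).trans_lt hn
  have hd := hunif.differentiableOn_of_complex isOpen_ball fun n => (hQd n).differentiableOn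
  have hlin : Differentiable ℂ (diagFlow r (-1)) := by
    rw [differentiable_pi]
    intro j
    unfold diagFlow
    fun_prop
  have hnhds : diagFlow r (-1) ⁻¹' ball 0 ε ∈ 𝓝 (0 : Fin N → ℂ) := by
    refine hlin.continuous.continuousAt.preimage_mem_nhds (isOpen_ball.mem_nhds ?_)
    have : diagFlow r (-1) 0 = 0 := by
      funext j
      simp [diagFlow]
    rw [this]
    exact mem_ball_self hε
  obtain ⟨δ, hδ, hsub⟩ := Metric.mem_nhds_iff.1 hnhds
  refine ⟨δ, hδ, (hd.comp hlin.differentiableOn hsub).congr fun w _ => ?_⟩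
  simp [diagFlow_one_neg_one]

/-! ### Polynomial approximation is stable under change of chart -/

namespace HasPolynomialApprox

variable {N : ℕ} {n : ℕ} {f g : (Fin N → ℂ) → ℂ}

theorem evalConj_add (p q : MvPolynomial (Fin N ⊕ Fin N) ℂ) (w : Fin N → ℂ) :
    evalConj (p + q) w = evalConj p w + evalConj q w := map_add _ _ _

theorem evalConj_mul (p q : MvPolynomial (Fin N ⊕ Fin N) ℂ) (w : Fin N → ℂ) :
    evalConj (p * q) w = evalConj p w * evalConj q w := map_mul _ _ _

theorem isBigO_one_evalConj (p : MvPolynomial (Fin N ⊕ Fin N) ℂ) :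
    evalConj p =O[𝓝 0] fun _ : Fin N → ℂ => (1 : ℝ) :=
  (continuous_evalConj p).continuousAt.isBigO_one ℝ

theorem isBigO_one (hf : HasPolynomialApprox n f) : f =O[𝓝 0] fun _ : Fin N → ℂ => (1 : ℝ) := by
  obtain ⟨p, hp⟩ := hf
  have h1 : (fun w : Fin N → ℂ => ‖w‖ ^ n) =O[𝓝 0] fun _ : Fin N → ℂ => (1 : ℝ) :=
    (continuous_norm.pow n).continuousAt.isBigO_one ℝ
  simpa using (hp.isBigO.trans h1).add (isBigO_one_evalConj p)

theorem congr (hf : HasPolynomialApprox n f) (h : f =ᶠ[𝓝 0] g) : HasPolynomialApprox n g := by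
  obtain ⟨p, hp⟩ := hf
  exact ⟨p, hp.congr' (h.mono fun w hw => by simp only [hw]) EventuallyEq.rfl⟩

theorem of_evalConj (p : MvPolynomial (Fin N ⊕ Fin N) ℂ) (h : ∀ w, f w = evalConj p w) :
    HasPolynomialApprox n f :=
  ⟨p, by simp [h]⟩

theorem const (c : ℂ) : HasPolynomialApprox n fun _ : Fin N → ℂ => c :=
  of_evalConj (MvPolynomial.C c) fun w => by simp [evalConj]

theorem add (hf : HasPolynomialApprox n f) (hg : HasPolynomialApprox n g) :
    HasPolynomialApprox n fun w => f w + g w := by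
  obtain ⟨p, hp⟩ := hf
  obtain ⟨q, hq⟩ := hg
  refine ⟨p + q, (hp.add hq).congr_left fun w => ?_⟩
  rw [evalConj_add]
  ring

/-- The degree of the approximating polynomial is not restricted, so products need no truncation. -/
theorem mul (hf : HasPolynomialApprox n f) (hg : HasPolynomialApprox n g) :
    HasPolynomialApprox n fun w => f w * g w := by
  have hfb := hf.isBigO_one
  obtain ⟨p, hp⟩ := hf
  obtain ⟨q, hq⟩ := hg
  refine ⟨p * q, ?_⟩
  have h1 := hfb.mul_isLittleO hq
  have h2 := hp.mul_isBigO (isBigO_one_evalConj q)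
  simp only [one_mul, mul_one] at h1 h2
  refine (h1.add h2).congr_left fun w => ?_
  rw [evalConj_mul]
  ring

theorem conj (hf : HasPolynomialApprox n f) :
    HasPolynomialApprox n fun w => (starRingEnd ℂ) (f w) := by
  obtain ⟨p, hp⟩ := hf
  -- Conjugation acts on the coefficients and exchanges the variables `w` and `w̄`.
  refine ⟨MvPolynomial.map (starRingEnd ℂ) (MvPolynomial.rename Sum.swap p), ?_⟩
  refine hp.norm_left.congr_left (fun w => ?_) |>.of_norm_left
  rw [← RCLike.norm_conj, map_sub]
  congr 2
  rw [evalConj, evalConj, MvPolynomial.eval_map, MvPolynomial.eval₂_rename, ← MvPolynomial.eval₂_id,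
    MvPolynomial.eval₂_comp_left, RingHom.comp_id]
  congr 1
  funext i
  rcases i with i | i <;> simp

theorem sum {ι : Type*} (s : Finset ι) {f : ι → (Fin N → ℂ) → ℂ}
    (hf : ∀ i ∈ s, HasPolynomialApprox n (f i)) :
    HasPolynomialApprox n fun w => ∑ i ∈ s, f i w := by
  classical
  induction s using Finset.induction_on with
  | empty => simpa using const 0
  | insert i s hi ih =>
    simp only [Finset.sum_insert hi]
    exact (hf i (Finset.mem_insert_self i s)).add
      (ih fun j hj => hf j (Finset.mem_insert_of_mem hj))

theorem prod {ι : Type*} (s : Finset ι) {f : ι → (Fin N → ℂ) → ℂ}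
    (hf : ∀ i ∈ s, HasPolynomialApprox n (f i)) :
    HasPolynomialApprox n fun w => ∏ i ∈ s, f i w := by
  classical
  induction s using Finset.induction_on with
  | empty => simpa using const 1
  | insert i s hi ih =>
    simp only [Finset.prod_insert hi]
    exact (hf i (Finset.mem_insert_self i s)).mul
      (ih fun j hj => hf j (Finset.mem_insert_of_mem hj))

theorem pow (hf : HasPolynomialApprox n f) (k : ℕ) : HasPolynomialApprox n fun w => f w ^ k := by
  simpa using prod (Finset.range k) fun _ _ => hf

theorem multilinear {k : ℕ} (m : ContinuousMultilinearMap ℂ (fun _ : Fin k => Fin N → ℂ) ℂ) :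
    HasPolynomialApprox n fun w => m fun _ => w := by
  have : (fun w : Fin N → ℂ => m fun _ => w)
      = fun w => ∑ s : Fin k → Fin N, (∏ i, w (s i)) * m fun i => Pi.single (s i) 1 := by
    funext w
    have hw : w = ∑ j, w j • (Pi.single j 1 : Fin N → ℂ) := by
      simpa using (pi_eq_sum_univ' w)
    conv_lhs => rw [hw]
    rw [m.map_sum]
    exact Finset.sum_congr rfl fun s _ => by rw [m.map_smul_univ, smul_eq_mul]
  rw [this]
  refine sum _ fun s _ => mul (prod _ fun i _ => ?_) (const _)
  exact of_evalConj (MvPolynomial.X (Sum.inl (s i))) fun w => by simp [evalConj]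

theorem of_analyticAt (hf : AnalyticAt ℂ f 0) : HasPolynomialApprox n f := by
  obtain ⟨q, hq⟩ := hf
  have h1 := hq.isBigO_sub_partialSum_pow (n + 1)
  have h2 : (fun w : Fin N → ℂ => ‖w‖ ^ (n + 1)) =o[𝓝 0] fun w : Fin N → ℂ => ‖w‖ ^ n :=
    (Asymptotics.isLittleO_pow_pow n.lt_succ_self).comp_tendsto
      (continuous_norm.tendsto' (0 : Fin N → ℂ) 0 norm_zero)
  have h3 := h1.trans_isLittleO h2
  have h4 : HasPolynomialApprox n fun w => q.partialSum (n + 1) w :=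
    sum _ fun k _ => multilinear (q k)
  obtain ⟨p, hp⟩ := h4
  refine ⟨p, (h3.add hp).congr_left fun w => ?_⟩
  simp

end HasPolynomialApprox

/-- The chart of the Taylor series need not be the linearizing one; `τ` is the transition map. Since
`τ w = O(w)`, the remainder stays `o(‖w‖^n)`. -/
theorem FHol.HasTaylorSeriesAtZero.hasPolynomialApprox_comp {N : ℕ} {f : (Fin N → ℂ) → ℂ}
    (hf : FHol.HasTaylorSeriesAtZero f) {τ : (Fin N → ℂ) → Fin N → ℂ} (hτ : AnalyticAt ℂ τ 0)
    (hτ0 : τ 0 = 0) (n : ℕ) : HasPolynomialApprox n (f ∘ τ) := by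
  obtain ⟨a, ha⟩ := hf
  have hτi : ∀ i, HasPolynomialApprox n fun w => τ w i := fun i =>
    HasPolynomialApprox.of_analyticAt ((analyticAt_pi_iff.1 hτ) i)
  have hτO : τ =O[𝓝 0] fun w : Fin N → ℂ => w := by
    simpa [hτ0] using hτ.differentiableAt.isBigO_sub
  have htend : Tendsto τ (𝓝 0) (𝓝 0) := by simpa [hτ0] using hτ.continuousAt.tendsto
  have h1 := ((ha n).comp_tendsto htend).trans_isBigO ((hτO.norm_left.norm_right).pow n)
  have h2 : HasPolynomialApprox n fun w =>
      ∑ j ∈ Finset.range (n + 1), FHol.taylorPart a j (τ w) := by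
    refine .sum _ fun j _ => .sum _ fun d _ => .sum _ fun k _ => .sum _ fun m _ => ?_
    refine .mul (.mul (.const _) (.prod _ fun i _ => .pow (hτi i) _)) (.prod _ fun i _ => .pow ?_ _)
    exact (hτi i).conj
  obtain ⟨p, hp⟩ := h2
  refine ⟨p, (h1.add hp).congr_left fun w => ?_⟩
  simp

/-! ### The local flow of a holomorphic vector field -/

/-- The Picard fixed point is sought among curves whose speed bound confines them to the ball, so
the solution comes with its confinement. -/
theorem IsPicardLindelof.exists_mem_closedBall_hasDerivWithinAt {E : Type*} [NormedAddCommGroup E]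
    [NormedSpace ℝ E] [CompleteSpace E] {f : ℝ → E → E} {tmin tmax : ℝ} {t₀ : Icc tmin tmax}
    {x₀ x : E} {a r L K : ℝ≥0} (hf : IsPicardLindelof f t₀ x₀ a r L K) (hx : x ∈ closedBall x₀ r) :
    ∃ α : ℝ → E, α t₀ = x ∧ (∀ t, α t ∈ closedBall x₀ a) ∧
      ∀ t ∈ Icc tmin tmax, HasDerivWithinAt α (f t (α t)) (Icc tmin tmax) t := by
  obtain ⟨α, hα⟩ := ODE.FunSpace.exists_isFixedPt_next hf hx
  have hmem : ∀ t, α.compProj t ∈ closedBall x₀ a :=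
    fun t => α.compProj_mem_closedBall hf.mul_max_le
  refine ⟨α.compProj, by rw [ODE.FunSpace.compProj_val, ← hα, ODE.FunSpace.next_apply₀], hmem,
    fun t ht => ?_⟩
  refine (ODE.hasDerivWithinAt_picard_Icc t₀.2 hf.continuousOn_uncurry
    α.continuous_compProj.continuousOn (fun _ _ => hmem _) x ht).congr_of_mem ?_ ht
  intro t' ht'
  nth_rw 1 [← hα]
  rw [ODE.FunSpace.compProj_of_mem ht', ODE.FunSpace.next_apply]

section Flow

variable {E : Type*} [NormedAddCommGroup E] [NormedSpace ℂ E]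

/-- The step `x ↦ x + h F(x)` of the explicit Euler method. -/
def eulerStep (F : E → E) (h : ℂ) (x : E) : E := x + h • F x

/-- A ball on which a holomorphic vector field is bounded and Lipschitz, together with a radius of
complex times for which solutions that start in the ball of half the radius stay in it. -/
structure IsFlowBox (F : E → E) (p : E) (R δ : ℝ) (L K : ℝ≥0) : Prop where
  R_pos : 0 < R
  δ_pos : 0 < δ
  differentiableOn : DifferentiableOn ℂ F (ball p R)
  norm_le : ∀ x ∈ closedBall p R, ‖F x‖ ≤ L
  lipschitz : LipschitzOnWith K F (closedBall p R)
  mul_le : δ * L ≤ R / 2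

namespace IsFlowBox

variable {F : E → E} {p : E} {R δ : ℝ} {L K : ℝ≥0}

theorem iterate_eulerStep_mem (hF : IsFlowBox F p R δ L K) {s : ℂ} (hs : s ∈ ball 0 δ) {q : E}
    (hq : q ∈ ball p (R / 2)) (n : ℕ) {j : ℕ} (hj : j ≤ n) :
    (eulerStep F (s / n))^[j] q ∈ ball p R := by
  have hs' : ‖s‖ < δ := by simpa using hs
  have hmem : ∀ x : E, ∀ i : ℕ, i ≤ n → ‖x - q‖ ≤ i * (‖s‖ / n * L) → x ∈ ball p R := by
    intro x i hi hx
    have h1 : (i : ℝ) * (‖s‖ / n * L) ≤ R / 2 := by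
      rcases Nat.eq_zero_or_pos n with rfl | hn
      · have : i = 0 := by omega
        simpa [this] using (half_pos hF.R_pos).le
      · have hn' : (0 : ℝ) < n := by exact_mod_cast hn
        calc (i : ℝ) * (‖s‖ / n * L) ≤ n * (‖s‖ / n * L) := by gcongr
          _ = ‖s‖ * L := by field_simp
          _ ≤ δ * L := by gcongr
          _ ≤ _ := hF.mul_le
    rw [mem_ball, dist_eq_norm] at hq ⊢
    have := norm_sub_le_norm_sub_add_norm_sub x q p
    linarith
  suffices h : ‖(eulerStep F (s / n))^[j] q - q‖ ≤ j * (‖s‖ / n * L) from hmem _ j hj h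
  induction j with
  | zero => simp
  | succ j ih =>
    have ih' := ih (by omega)
    rw [Function.iterate_succ_apply', eulerStep, add_sub_right_comm]
    refine (norm_add_le _ _).trans ?_
    have hb := hF.norm_le _ (ball_subset_closedBall (hmem _ j (by omega) ih'))
    have : ‖(s / n) • F ((eulerStep F (s / n))^[j] q)‖ ≤ ‖s‖ / n * L := by
      rw [norm_smul, norm_div, Complex.norm_natCast]
      gcongr
    push_cast
    linarith

theorem differentiableOn_iterate_eulerStep (hF : IsFlowBox F p R δ L K) (n : ℕ) {j : ℕ}
    (hj : j ≤ n) : DifferentiableOn ℂ (fun x : ℂ × E => (eulerStep F (x.1 / n))^[j] x.2)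
      (ball 0 δ ×ˢ ball p (R / 2)) := by
  induction j with
  | zero => exact differentiableOn_snd
  | succ j ih =>
    simp only [Function.iterate_succ_apply', eulerStep]
    have ih' := ih (by omega)
    refine ih'.add (DifferentiableOn.smul (by fun_prop) ?_)
    exact hF.differentiableOn.comp ih' fun x hx => hF.iterate_eulerStep_mem hx.1 hx.2 n (by omega)

/-- A solution of `y' = s F(y)` on the unit interval. -/
structure _root_.IsRaySolution (F : E → E) (s : ℂ) (p : E) (R : ℝ) (y : ℝ → E) : Prop where
  mem : ∀ t ∈ Icc (0 : ℝ) 1, y t ∈ closedBall p R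
  hasDerivWithinAt : ∀ t ∈ Icc (0 : ℝ) 1, HasDerivWithinAt y (s • F (y t)) (Icc 0 1) t

/-- The local truncation error is quadratic in `h`: the speed is at most `δ L`, so by the Lipschitz
condition the velocity varies by `O(h)` over a step of length `h`. -/
theorem norm_step_le (hF : IsFlowBox F p R δ L K) {s : ℂ} (hs : s ∈ ball 0 δ) {y : ℝ → E}
    (hy : IsRaySolution F s p R y) {t h : ℝ} (ht : 0 ≤ t) (hh : 0 ≤ h) (hth : t + h ≤ 1) :
    ‖y (t + h) - y t - (h * s : ℂ) • F (y t)‖ ≤ δ ^ 2 * K * L * h ^ 2 := by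
  have hs' : ‖s‖ ≤ δ := by simpa using (mem_ball_zero_iff.1 hs).le
  have hsub : Icc t (t + h) ⊆ Icc (0 : ℝ) 1 := Icc_subset_Icc ht hth
  have htm : t ∈ Icc (0 : ℝ) 1 := hsub (left_mem_Icc.2 (by linarith))
  have hδ := hF.δ_pos
  have h1 : ∀ τ ∈ Icc t (t + h), ‖y τ - y t‖ ≤ δ * L * (τ - t) := by
    refine norm_image_sub_le_of_norm_deriv_le_segment'
      (fun τ hτ => (hy.hasDerivWithinAt τ (hsub hτ)).mono hsub) fun τ hτ => ?_
    rw [norm_smul]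
    gcongr
    exact hF.norm_le _ (hy.mem _ (hsub (Ico_subset_Icc_self hτ)))
  have h2 : ∀ τ ∈ Icc t (t + h),
      ‖(y τ - (τ * s : ℂ) • F (y t)) - (y t - (t * s : ℂ) • F (y t))‖
        ≤ δ * (K * (δ * L * h)) * (τ - t) := by
    refine norm_image_sub_le_of_norm_deriv_le_segment'
      (f' := fun τ => s • F (y τ) - s • F (y t)) (fun τ hτ => ?_) fun τ hτ => ?_
    · refine ((hy.hasDerivWithinAt τ (hsub hτ)).mono hsub).sub (HasDerivAt.hasDerivWithinAt ?_)
      have := ((Complex.ofRealCLM.hasDerivAt (x := τ)).mul_const s).smul_const (F (y t))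
      simpa using this
    · rw [← smul_sub, norm_smul]
      have hτ' := Ico_subset_Icc_self hτ
      gcongr
      refine (hF.lipschitz.norm_sub_le (hy.mem _ (hsub hτ')) (hy.mem _ htm)).trans ?_
      gcongr
      refine (h1 τ hτ').trans ?_
      gcongr
      linarith [hτ'.2]
  have h3 := h2 (t + h) (right_mem_Icc.2 (by linarith))
  have e : y (t + h) - ((t + h : ℝ) * s : ℂ) • F (y t) - (y t - (t * s : ℂ) • F (y t))
      = y (t + h) - y t - (h * s : ℂ) • F (y t) := by
    push_cast
    rw [add_mul, add_smul]
    abel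
  rw [e] at h3
  refine h3.trans (le_of_eq ?_)
  ring

/-- Discrete Grönwall: each step multiplies the error by at most `1 + δ K / n` and adds `O(1 / n ^
2)`. The bound is uniform in `s` and `q`. -/
theorem norm_iterate_eulerStep_sub_le (hF : IsFlowBox F p R δ L K) {s : ℂ} (hs : s ∈ ball 0 δ)
    {q : E} (hq : q ∈ ball p (R / 2)) {y : ℝ → E} (hy : IsRaySolution F s p R y) (hy0 : y 0 = q)
    {n : ℕ} (hn : 0 < n) :
    ‖(eulerStep F (s / n))^[n] q - y 1‖ ≤ δ ^ 2 * K * L * Real.exp (δ * K) / n := by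
  have hn' : (0 : ℝ) < n := by exact_mod_cast hn
  have hs' : ‖s‖ ≤ δ := by simpa using (mem_ball_zero_iff.1 hs).le
  have hδ := hF.δ_pos
  set B : ℝ := δ ^ 2 * K * L with hB
  have hB0 : 0 ≤ B := by positivity
  set a : ℝ := δ * K / n with ha
  have ha0 : 0 ≤ a := by positivity
  have key : ∀ j ≤ n, ‖(eulerStep F (s / n))^[j] q - y (j / n)‖
      ≤ j * (B / n ^ 2) * (1 + a) ^ j := by
    intro j
    induction j with
    | zero => simp [hy0]
    | succ j ih =>
      intro hj
      have ih' := ih (by omega)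
      rw [Function.iterate_succ_apply', eulerStep]
      set x := (eulerStep F (s / n))^[j] q with hx
      have hxm : x ∈ closedBall p R :=
        ball_subset_closedBall (hF.iterate_eulerStep_mem hs hq n (by omega))
      have hjn : (j : ℝ) / n + 1 / n ≤ 1 := by
        rw [← add_div, div_le_one hn']
        exact_mod_cast hj
      have hym : y (j / n) ∈ closedBall p R :=
        hy.mem _ ⟨by positivity, le_trans (by simp) hjn⟩
      have hstep := hF.norm_step_le hs hy (t := j / n) (h := 1 / n) (by positivity)
        (by positivity) hjn
      have e1 : ((j + 1 : ℕ) : ℝ) / n = j / n + 1 / n := by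
        push_cast
        rw [add_div]
      have e2 : (((1 / n : ℝ) : ℂ) * s) = s / n := by
        push_cast
        ring
      rw [e2] at hstep
      rw [e1]
      have e3 : x + (s / n) • F x - y (j / n + 1 / n)
          = (x - y (j / n)) + (s / n) • (F x - F (y (j / n)))
            - (y (j / n + 1 / n) - y (j / n) - (s / n) • F (y (j / n))) := by
        rw [smul_sub]
        abel
      have h4 : ‖(s / n) • (F x - F (y (j / n)))‖ ≤ a * ‖x - y (j / n)‖ := by
        rw [norm_smul, norm_div, Complex.norm_natCast]
        calc _ ≤ δ / n * (K * ‖x - y (j / n)‖) := by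
              gcongr
              exact hF.lipschitz.norm_sub_le hxm hym
          _ = _ := by rw [ha]; ring
      rw [e3]
      have h5 : 1 ≤ (1 + a) ^ (j + 1) := one_le_pow₀ (by linarith)
      calc _ ≤ ‖x - y (j / n)‖ + a * ‖x - y (j / n)‖ + B * (1 / n) ^ 2 := by
            refine (norm_sub_le _ _).trans (add_le_add ((norm_add_le _ _).trans ?_) hstep)
            gcongr
        _ = (1 + a) * ‖x - y (j / n)‖ + B / n ^ 2 * 1 := by ring
        _ ≤ (1 + a) * (j * (B / n ^ 2) * (1 + a) ^ j) + B / n ^ 2 * (1 + a) ^ (j + 1) := by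
            gcongr
        _ = _ := by
            push_cast
            ring
  have h := key n le_rfl
  rw [div_self hn'.ne'] at h
  refine h.trans ?_
  have hexp : (1 + a) ^ n ≤ Real.exp (δ * K) := by
    calc (1 + a) ^ n ≤ Real.exp a ^ n := by
          gcongr
          rw [add_comm]
          exact Real.add_one_le_exp a
      _ = Real.exp (δ * K) := by
          rw [← Real.exp_nat_mul, ha]
          congr 1
          field_simp
  calc _ ≤ n * (B / n ^ 2) * Real.exp (δ * K) := by gcongr
    _ = _ := by field_simp

theorem tendsto_iterate_eulerStep (hF : IsFlowBox F p R δ L K) {s : ℂ} (hs : s ∈ ball 0 δ)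
    {q : E} (hq : q ∈ ball p (R / 2)) {y : ℝ → E} (hy : IsRaySolution F s p R y) (hy0 : y 0 = q) :
    Tendsto (fun n : ℕ => (eulerStep F (s / n))^[n] q) atTop (𝓝 (y 1)) := by
  rw [tendsto_iff_norm_sub_tendsto_zero]
  refine squeeze_zero' (Eventually.of_forall fun _ => norm_nonneg _)
    ((eventually_gt_atTop 0).mono fun n hn => hF.norm_iterate_eulerStep_sub_le hs hq hy hy0 hn) ?_
  exact tendsto_const_div_atTop_nhds_zero_nat _

theorem exists_isRaySolution [CompleteSpace E] (hF : IsFlowBox F p R δ L K) {s : ℂ}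
    (hs : s ∈ ball 0 δ) {q : E} (hq : q ∈ ball p (R / 2)) :
    ∃ y : ℝ → E, y 0 = q ∧ IsRaySolution F s p R y := by
  have hs' : ‖s‖ ≤ δ := by simpa using (mem_ball_zero_iff.1 hs).le
  have hPL : IsPicardLindelof (fun _ : ℝ => fun x => s • F x)
      (⟨0, left_mem_Icc.2 zero_le_one⟩ : Icc (0 : ℝ) 1) p ⟨R, hF.R_pos.le⟩
      ⟨R / 2, (half_pos hF.R_pos).le⟩ (‖s‖₊ * L) (‖s‖₊ * K) := by
    refine IsPicardLindelof.of_time_independent (fun x hx => ?_) ?_ ?_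
    · rw [norm_smul]
      push_cast
      gcongr
      exact hF.norm_le x hx
    · exact (lipschitzWith_smul s).lipschitzOnWith.comp hF.lipschitz (mapsTo_univ _ _)
    · have : ‖s‖ * L ≤ δ * L := by gcongr
      have h2 : ‖s‖ * L ≤ R - R / 2 := by linarith [hF.mul_le]
      simp only [NNReal.coe_mul, coe_nnnorm, sub_zero, sub_self, zero_le_one, sup_of_le_left,
        mul_one]
      exact h2
  obtain ⟨α, hα0, hαm, hα⟩ :=
    hPL.exists_mem_closedBall_hasDerivWithinAt (ball_subset_closedBall hq)
  exact ⟨α, hα0, fun t _ => hαm t, hα⟩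

end IsFlowBox

/-- The local flow of a holomorphic vector field, as the limit of the Euler method. -/
noncomputable def localFlow [Nonempty E] (F : E → E) (s : ℂ) (q : E) : E :=
  limUnder atTop fun n : ℕ => (eulerStep F (s / n))^[n] q

namespace IsFlowBox

variable {F : E → E} {p : E} {R δ : ℝ} {L K : ℝ≥0}

theorem localFlow_eq (hF : IsFlowBox F p R δ L K) {s : ℂ} (hs : s ∈ ball 0 δ)
    {q : E} (hq : q ∈ ball p (R / 2)) {y : ℝ → E} (hy : IsRaySolution F s p R y) (hy0 : y 0 = q) :
    localFlow F s q = y 1 :=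
  (hF.tendsto_iterate_eulerStep hs hq hy hy0).limUnder_eq

theorem localFlow_mul_eq (hF : IsFlowBox F p R δ L K) {s : ℂ} (hs : s ∈ ball 0 δ)
    {q : E} (hq : q ∈ ball p (R / 2)) {y : ℝ → E} (hy : IsRaySolution F s p R y) (hy0 : y 0 = q)
    {t : ℝ} (ht : t ∈ Icc (0 : ℝ) 1) : localFlow F (t * s) q = y t := by
  have hmaps : MapsTo (fun τ : ℝ => τ * t) (Icc 0 1) (Icc 0 1) := fun τ hτ =>
    ⟨mul_nonneg hτ.1 ht.1, mul_le_one₀ hτ.2 ht.1 ht.2⟩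
  have hts : (t * s : ℂ) ∈ ball (0 : ℂ) δ := by
    rw [mem_ball_zero_iff] at hs ⊢
    rw [norm_mul, Complex.norm_real, Real.norm_of_nonneg ht.1]
    exact (mul_le_of_le_one_left (norm_nonneg _) ht.2).trans_lt hs
  have := hF.localFlow_eq hts hq (y := fun τ => y (τ * t))
    ⟨fun τ hτ => hy.mem _ (hmaps hτ), fun τ hτ => ?_⟩ (by simpa using hy0)
  · simpa using this
  · have h1 := (hy.hasDerivWithinAt _ (hmaps hτ)).scomp τ
      ((hasDerivAt_mul_const t).hasDerivWithinAt (s := Icc 0 1) (x := τ)) hmaps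
    rw [mul_smul]
    simpa only [Function.comp_def, Complex.coe_smul] using h1

theorem localFlow_mem [CompleteSpace E] (hF : IsFlowBox F p R δ L K) {s : ℂ} (hs : s ∈ ball 0 δ)
    {q : E} (hq : q ∈ ball p (R / 2)) : localFlow F s q ∈ closedBall p R := by
  obtain ⟨y, hy0, hy⟩ := hF.exists_isRaySolution hs hq
  rw [hF.localFlow_eq hs hq hy hy0]
  exact hy.mem 1 (right_mem_Icc.2 zero_le_one)

theorem localFlow_zero [CompleteSpace E] (hF : IsFlowBox F p R δ L K)
    {q : E} (hq : q ∈ ball p (R / 2)) : localFlow F 0 q = q := by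
  have h0 := mem_ball_self (x := (0 : ℂ)) hF.δ_pos
  obtain ⟨y, hy0, hy⟩ := hF.exists_isRaySolution h0 hq
  simpa [hy0] using hF.localFlow_mul_eq h0 hq hy hy0 (left_mem_Icc.2 zero_le_one)

/-- Euler iterates are jointly holomorphic in `(s, q)` and converge uniformly, so joint holomorphy
passes to the flow. -/
theorem differentiableOn_localFlow [CompleteSpace E] (hF : IsFlowBox F p R δ L K) :
    DifferentiableOn ℂ (fun x : ℂ × E => localFlow F x.1 x.2) (ball 0 δ ×ˢ ball p (R / 2)) := by
  refine TendstoUniformlyOn.differentiableOn_of_complex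
    (f := fun n x => (eulerStep F (x.1 / n))^[n] x.2) (isOpen_ball.prod isOpen_ball)
    (fun n => hF.differentiableOn_iterate_eulerStep n le_rfl) ?_
  rw [Metric.tendstoUniformlyOn_iff]
  intro ε hε
  filter_upwards [(tendsto_const_div_atTop_nhds_zero_nat
    (δ ^ 2 * K * L * Real.exp (δ * K))).eventually_lt_const hε, eventually_gt_atTop 0]
    with n hn hn0 x hx
  obtain ⟨y, hy0, hy⟩ := hF.exists_isRaySolution hx.1 hx.2
  rw [dist_comm, dist_eq_norm, hF.localFlow_eq hx.1 hx.2 hy hy0]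
  exact (hF.norm_iterate_eulerStep_sub_le hx.1 hx.2 hy hy0 hn0).trans_lt hn

theorem hasDerivAt_localFlow [CompleteSpace E] (hF : IsFlowBox F p R δ L K) {s : ℂ}
    (hs : s ∈ ball 0 δ) {q : E} (hq : q ∈ ball p (R / 2)) :
    HasDerivAt (fun s => localFlow F s q) (F (localFlow F s q)) s := by
  have hd : ∀ s ∈ ball (0 : ℂ) δ, DifferentiableAt ℂ (fun s => localFlow F s q) s := by
    intro s hs
    have h1 := hF.differentiableOn_localFlow.differentiableAt
      ((isOpen_ball.prod isOpen_ball).mem_nhds (mk_mem_prod hs hq))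
    exact h1.comp (f := fun s : ℂ => (s, q)) s (differentiableAt_id.prodMk (differentiableAt_const q))
  -- The flow at time `t * s` is the ray solution at real time `t`; comparing the two derivatives in
  -- `t` gives the complex equation multiplied by `s`.
  have key : ∀ s ∈ ball (0 : ℂ) δ, ∀ t ∈ Icc (0 : ℝ) 1, (t * s : ℂ) ∈ ball (0 : ℂ) δ →
      s • deriv (fun s => localFlow F s q) (t * s) = s • F (localFlow F (t * s) q) := by
    intro s hs t ht hts
    obtain ⟨y, hy0, hy⟩ := hF.exists_isRaySolution hs hq
    have h1 : HasDerivWithinAt y (s • deriv (fun s => localFlow F s q) (t * s)) (Icc 0 1) t := by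
      have h2 : HasDerivAt (fun t : ℝ => (t : ℂ) * s) s t := by
        simpa using (Complex.ofRealCLM.hasDerivAt (x := t)).mul_const s
      have h3 := ((hd _ hts).hasDerivAt.scomp t h2).hasDerivWithinAt (s := Icc 0 1)
      refine h3.congr_of_mem (fun τ hτ => ?_) ht
      exact (hF.localFlow_mul_eq hs hq hy hy0 hτ).symm
    have h4 := hy.hasDerivWithinAt t ht
    rw [← hF.localFlow_mul_eq hs hq hy hy0 ht] at h4
    exact (uniqueDiffOn_Icc zero_lt_one t ht).eq_deriv _ h1 h4
  have hderiv : deriv (fun s => localFlow F s q) s = F (localFlow F s q) := by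
    -- At `s = 0` the factor cannot be cancelled, so the start `t = 0` of the nonzero ray through `δ
    -- / 2` is used.
    rcases eq_or_ne s 0 with rfl | hs0
    · have hδ := hF.δ_pos
      have hm : ((δ / 2 : ℝ) : ℂ) ∈ ball (0 : ℂ) δ := by
        rw [mem_ball_zero_iff, Complex.norm_real, Real.norm_of_nonneg (by positivity)]
        linarith
      have := key _ hm 0 (left_mem_Icc.2 zero_le_one) (by simpa using hδ)
      simp only [Complex.ofReal_zero, zero_mul] at this
      have hne : ((δ / 2 : ℝ) : ℂ) ≠ 0 := by exact_mod_cast (half_pos hδ).ne'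
      exact smul_right_injective E hne this
    · have := key s hs 1 (right_mem_Icc.2 zero_le_one) (by simpa using hs)
      simp only [Complex.ofReal_one, one_mul] at this
      exact smul_right_injective E hs0 this
  rw [← hderiv]
  exact (hd s hs).hasDerivAt

/-- Two curves in the box that solve the same complex differential equation near a point agree
near it: such a curve is given by the local flow. -/
theorem eventually_eq_localFlow (hF : IsFlowBox F p R δ L K) {x : ℂ → E} {ζ₀ : ℂ}
    (hx0 : x ζ₀ = p) (hx : ∀ᶠ ζ in 𝓝 ζ₀, HasDerivAt x (F (x ζ)) ζ) :
    ∀ᶠ ζ in 𝓝 ζ₀, x ζ = localFlow F (ζ - ζ₀) p := by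
  have hcont : ∀ᶠ ζ in 𝓝 ζ₀, x ζ ∈ closedBall p R := by
    refine hx.self_of_nhds.continuousAt.eventually_mem ?_
    rw [hx0]
    exact closedBall_mem_nhds p hF.R_pos
  obtain ⟨r, hr, hrx⟩ := Metric.eventually_nhds_iff_ball.1 (hx.and hcont)
  refine Metric.eventually_nhds_iff_ball.2 ⟨min r δ, lt_min hr hF.δ_pos, fun ζ hζ => ?_⟩
  rw [mem_ball, dist_eq_norm, lt_min_iff] at hζ
  have hmem : ∀ t ∈ Icc (0 : ℝ) 1, ζ₀ + t * (ζ - ζ₀) ∈ ball ζ₀ r := by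
    intro t ht
    rw [mem_ball, dist_eq_norm, add_sub_cancel_left, norm_mul, Complex.norm_real,
      Real.norm_of_nonneg ht.1]
    exact (mul_le_of_le_one_left (norm_nonneg _) ht.2).trans_lt hζ.1
  have := hF.localFlow_eq (s := ζ - ζ₀) (q := p) (y := fun t : ℝ => x (ζ₀ + t * (ζ - ζ₀)))
    (by simpa using hζ.2) (mem_ball_self (half_pos hF.R_pos))
    ⟨fun t ht => (hrx _ (hmem t ht)).2, fun t ht => ?_⟩ (by simpa using hx0)
  · simpa using this.symm
  · have h2 : HasDerivAt (fun t : ℝ => ζ₀ + (t : ℂ) * (ζ - ζ₀)) (ζ - ζ₀) t := by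
      simpa using ((Complex.ofRealCLM.hasDerivAt (x := t)).mul_const (ζ - ζ₀)).const_add ζ₀
    exact ((hrx _ (hmem t ht)).1.scomp t h2).hasDerivWithinAt

end IsFlowBox

theorem exists_isFlowBox {F : E → E} {p : E} {s : Set E} (hs : s ∈ 𝓝 p)
    (hd : DifferentiableOn ℂ F s) (hF : ContDiffAt ℂ 1 F p) :
    ∃ R δ : ℝ, ∃ L K : ℝ≥0, closedBall p R ⊆ s ∧ IsFlowBox F p R δ L K := by
  obtain ⟨K, t, ht, hK⟩ := hF.exists_lipschitzOnWith
  obtain ⟨R, hR, hRs⟩ := Metric.nhds_basis_closedBall.mem_iff.1 (inter_mem hs ht)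
  have hlip := hK.mono (hRs.trans inter_subset_right)
  -- The summand `1` keeps `L` positive, so that `δ = R / 2 / L` is a positive radius.
  set L : ℝ≥0 := ‖F p‖₊ + K * ⟨R, hR.le⟩ + 1 with hL
  have hL0 : 0 < L := by positivity
  refine ⟨R, R / 2 / L, L, K, hRs.trans inter_subset_left, hR, by positivity,
    hd.mono (ball_subset_closedBall.trans (hRs.trans inter_subset_left)), fun x hx => ?_, hlip, ?_⟩
  · have h1 := hlip.norm_sub_le hx (mem_closedBall_self hR.le)
    have h2 : ‖x - p‖ ≤ R := by rwa [← dist_eq_norm]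
    have h3 : ‖F x‖ ≤ ‖F p‖ + ‖F x - F p‖ := norm_le_insert' _ _
    have h4 : (K : ℝ) * ‖x - p‖ ≤ K * R := by gcongr
    have h5 : (L : ℝ) = ‖F p‖ + K * R + 1 := by rw [hL]; rfl
    linarith
  · have : (L : ℝ) ≠ 0 := by exact_mod_cast hL0.ne'
    exact le_of_eq (by field_simp)

end Flow

/-! ### Subharmonicity and Hartogs' lemma -/

/-- In Jensen's formula the zeros contribute nonnegative terms, and there are no poles. -/
theorem AnalyticOnNhd.log_norm_le_circleAverage {f : ℂ → ℂ} {c : ℂ} {R : ℝ} (hR : 0 < R)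
    (hf : AnalyticOnNhd ℂ f (closedBall c R)) (hc : f c ≠ 0) :
    Real.log ‖f c‖ ≤ Real.circleAverage (fun z => Real.log ‖f z‖) c R := by
  have hf' : AnalyticOnNhd ℂ f (closedBall c |R|) := by rwa [abs_of_pos hR]
  rw [hf'.circleAverage_log_norm hR.ne' hc]
  refine le_add_of_nonneg_left (finsum_nonneg fun u => ?_)
  by_cases hu : u ∈ closedBall c |R|
  · refine mul_nonneg ?_ ?_
    · exact_mod_cast (MeromorphicOn.AnalyticOnNhd.divisor_nonneg hf') u
    · rcases eq_or_ne u c with rfl | huc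
      · simp
      · refine Real.log_nonneg ?_
        rw [abs_of_pos hR, mem_closedBall, dist_comm, dist_eq_norm] at hu
        rw [← div_eq_mul_inv, one_le_div (norm_pos_iff.2 (sub_ne_zero.2 huc.symm))]
        exact hu
  · rw [Function.locallyFinsuppWithin.apply_eq_zero_of_notMem _ hu]
    simp

/-- Positive powers of the absolute value of a holomorphic function are subharmonic. -/
theorem AnalyticOnNhd.norm_rpow_le_circleAverage {f : ℂ → ℂ} {c : ℂ} {R p : ℝ} (hR : 0 < R)
    (hp : 0 < p) (hf : AnalyticOnNhd ℂ f (closedBall c R)) :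
    ‖f c‖ ^ p ≤ Real.circleAverage (fun z => ‖f z‖ ^ p) c R := by
  have hR' : |R| = R := abs_of_pos hR
  by_cases hc : f c = 0
  · rw [hc, norm_zero, Real.zero_rpow hp.ne']
    exact Real.circleAverage_nonneg_of_nonneg fun x _ => by positivity
  have ha : 0 < ‖f c‖ := norm_pos_iff.2 hc
  set a := ‖f c‖ with ha_def
  -- `T` is the tangent line at `log a` of `x ↦ exp (p x)`, evaluated at `log ‖f z‖`; by convexity
  -- it lies below `‖f z‖ ^ p` wherever `f z ≠ 0`.
  set T : ℂ → ℝ := fun z => (a ^ p * (1 - p * Real.log a)) + (a ^ p * p) • Real.log ‖f z‖ with hT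
  have hlog : CircleIntegrable (fun z => Real.log ‖f z‖) c R := by
    refine MeromorphicOn.circleIntegrable_log_norm fun z hz => ?_
    rw [hR'] at hz
    exact (hf z (sphere_subset_closedBall hz)).meromorphicAt
  have hTi : CircleIntegrable T c R := (circleIntegrable_const _ _ _).add (hlog.const_smul)
  have hTavg : Real.circleAverage T c R
      = a ^ p * (1 - p * Real.log a) + a ^ p * p * Real.circleAverage (fun z => Real.log ‖f z‖) c R := by
    have h1 := Real.circleAverage_fun_add (circleIntegrable_const (a ^ p * (1 - p * Real.log a)) c R)
      (hlog.const_smul (a := a ^ p * p))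
    rw [Real.circleAverage_const, Real.circleAverage_smul, smul_eq_mul] at h1
    exact h1
  have hpow : CircleIntegrable (fun z => ‖f z‖ ^ p) c R := by
    refine ContinuousOn.circleIntegrable hR.le ?_
    exact ((hf.continuousOn.mono sphere_subset_closedBall).norm).rpow_const fun _ _ => Or.inr hp.le
  -- At zeros of `f` the convention `Real.log 0 = 0` can break the tangent inequality. They form a
  -- discrete set, so passing to the maximum leaves the average unchanged.
  have hcod : (fun z => ‖f z‖ ^ p) =ᶠ[codiscreteWithin (sphere c |R|)]
      fun z => max (‖f z‖ ^ p) (T z) := by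
    have h1 : f ⁻¹' {0}ᶜ ∈ codiscreteWithin (closedBall c R) :=
      hf.preimage_zero_mem_codiscreteWithin hc (mem_closedBall_self hR.le)
        ((convex_closedBall c R).isConnected ⟨c, mem_closedBall_self hR.le⟩)
    have h2 := codiscreteWithin_mono (U₁ := sphere c |R|) (by
      rw [hR']; exact sphere_subset_closedBall) h1
    filter_upwards [h2] with z hz
    have hz' : 0 < ‖f z‖ := norm_pos_iff.2 hz
    refine (max_eq_left ?_).symm
    have h3 := Real.add_one_le_exp (p * (Real.log ‖f z‖ - Real.log a))
    have h4 : ‖f z‖ ^ p = a ^ p * Real.exp (p * (Real.log ‖f z‖ - Real.log a)) := by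
      rw [Real.rpow_def_of_pos hz', Real.rpow_def_of_pos ha, ← Real.exp_add]
      ring_nf
    rw [h4, hT]
    calc _ = a ^ p * (p * (Real.log ‖f z‖ - Real.log a) + 1) := by
          simp only [smul_eq_mul]
          ring
      _ ≤ _ := by gcongr
  calc a ^ p ≤ Real.circleAverage T c R := by
        rw [hTavg]
        have := hf.log_norm_le_circleAverage hR hc
        have h5 : 0 ≤ a ^ p * p * (Real.circleAverage (fun z => Real.log ‖f z‖) c R - Real.log a) :=
          mul_nonneg (by positivity) (sub_nonneg.2 this)
        linarith
    _ ≤ Real.circleAverage (fun z => max (‖f z‖ ^ p) (T z)) c R :=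
        Real.circleAverage_mono hTi (hpow.congr_codiscreteWithin hcod) fun z _ => le_max_right _ _
    _ = _ := (Real.circleAverage_congr_codiscreteWithin hcod hR.ne').symm

theorem measurePreserving_circle_smul {N : ℕ} (a : Circle) :
    MeasurePreserving (fun v : Fin N → ℂ => (a : ℂ) • v) :=
  volume_preserving_pi (f := fun _ => fun z : ℂ => (a : ℂ) * z)
    fun _ => (rotation a).measurePreserving

theorem setIntegral_closedBall_circle_smul {N : ℕ} (a : Circle) (g : (Fin N → ℂ) → ℝ) (ρ : ℝ) :
    ∫ v in closedBall 0 ρ, g ((a : ℂ) • v) = ∫ v in closedBall 0 ρ, g v := by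
  have hemb : MeasurableEmbedding (fun v : Fin N → ℂ => (a : ℂ) • v) :=
    (Homeomorph.smulOfNeZero (a : ℂ) (Circle.coe_ne_zero a)).measurableEmbedding
  have hpre : (fun v : Fin N → ℂ => (a : ℂ) • v) ⁻¹' closedBall 0 ρ = closedBall 0 ρ := by
    ext v
    simp [norm_smul, Circle.norm_coe]
  have := (measurePreserving_circle_smul a).setIntegral_preimage_emb hemb g (closedBall 0 ρ)
  rwa [hpre] at this

/-- Rotations `v ↦ exp (iθ) v` preserve volume and the ball. Averaging the integral over `θ` and
exchanging the integrals reduces the claim to the one-variable mean inequality on each complex line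
through `q`. -/
theorem volume_mul_norm_rpow_le_setIntegral {N : ℕ} {c : (Fin N → ℂ) → ℂ} {q : Fin N → ℂ}
    {ρ ρ' p : ℝ} (hρ : ρ < ρ') (hp : 0 < p) (hc : DifferentiableOn ℂ c (ball q ρ')) :
    volume.real (closedBall q ρ) * ‖c q‖ ^ p ≤ ∫ x in closedBall q ρ, ‖c x‖ ^ p := by
  set g : (Fin N → ℂ) → ℝ := fun v => ‖c (q + v)‖ ^ p with hg
  have hmem : ∀ z : ℂ, ∀ v ∈ closedBall (0 : Fin N → ℂ) ρ, ‖z‖ ≤ 1 → q + z • v ∈ ball q ρ' := by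
    intro z v hv hz
    rw [mem_closedBall_zero_iff] at hv
    rw [mem_ball, dist_eq_norm, add_sub_cancel_left, norm_smul]
    exact (mul_le_of_le_one_left (norm_nonneg _) hz).trans_lt (hv.trans_lt hρ)
  have htrans : ∫ x in closedBall q ρ, ‖c x‖ ^ p = ∫ v in closedBall 0 ρ, g v := by
    have h1 := (measurePreserving_add_left volume q).setIntegral_preimage_emb
      (MeasurableEquiv.addLeft q).measurableEmbedding (fun x => ‖c x‖ ^ p) (closedBall q ρ)
    rw [← h1]
    congr 2
    ext v
    simp [dist_eq_norm]
  have hvol : volume.real (closedBall q ρ) = volume.real (closedBall (0 : Fin N → ℂ) ρ) := by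
    rw [Measure.real, Measure.real, Measure.addHaar_closedBall_center]
  rw [htrans, hvol]
  have hcont : ContinuousOn (fun x : ℝ × (Fin N → ℂ) => g (circleMap 0 1 x.1 • x.2))
      (Icc 0 (2 * Real.pi) ×ˢ closedBall 0 ρ) := by
    refine ContinuousOn.rpow_const (ContinuousOn.norm ?_) fun _ _ => Or.inr hp.le
    refine hc.continuousOn.comp ?_ fun x hx => hmem _ _ hx.2 (by simp)
    exact (continuous_const.add (((continuous_circleMap 0 1).comp continuous_fst).smul
      continuous_snd)).continuousOn
  have hint : Integrable (Function.uncurry fun (θ : ℝ) (v : Fin N → ℂ) => g (circleMap 0 1 θ • v))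
      ((volume.restrict (Set.uIoc 0 (2 * Real.pi))).prod (volume.restrict (closedBall 0 ρ))) := by
    rw [Measure.prod_restrict]
    have h1 := hcont.integrableOn_compact (μ := (volume : Measure ℝ).prod volume)
      (isCompact_Icc.prod (isCompact_closedBall 0 ρ))
    refine h1.mono_set (prod_mono ?_ subset_rfl)
    rw [Set.uIoc_of_le Real.two_pi_pos.le]
    exact Ioc_subset_Icc_self
  have hswap := intervalIntegral_integral_swap hint
  have hconst : ∀ θ : ℝ, ∫ v in closedBall 0 ρ, g (circleMap 0 1 θ • v)
      = ∫ v in closedBall 0 ρ, g v := by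
    intro θ
    have := setIntegral_closedBall_circle_smul (Circle.exp θ) g ρ
    rw [← this]
    simp [circleMap, Circle.coe_exp]
  simp only [hconst, intervalIntegral.integral_const, sub_zero, smul_eq_mul] at hswap
  have hpt : ∀ v ∈ closedBall (0 : Fin N → ℂ) ρ,
      2 * Real.pi * ‖c q‖ ^ p ≤ ∫ θ in (0 : ℝ)..2 * Real.pi, g (circleMap 0 1 θ • v) := by
    intro v hv
    have hopen : IsOpen ((fun z : ℂ => q + z • v) ⁻¹' ball q ρ') :=
      isOpen_ball.preimage (by fun_prop)
    have han : AnalyticOnNhd ℂ (fun z : ℂ => c (q + z • v)) (closedBall 0 1) := by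
      refine AnalyticOnNhd.mono (DifferentiableOn.analyticOnNhd ?_ hopen)
        fun z hz => hmem z v hv (by simpa using hz)
      exact hc.comp (by fun_prop) (mapsTo_preimage _ _)
    have h1 := han.norm_rpow_le_circleAverage one_pos hp
    rw [Real.circleAverage_def, smul_eq_mul, zero_smul, add_zero,
      ← div_eq_inv_mul, le_div_iff₀ Real.two_pi_pos] at h1
    rw [mul_comm]
    exact h1
  have hle : ∫ v in closedBall (0 : Fin N → ℂ) ρ, 2 * Real.pi * ‖c q‖ ^ p
      ≤ ∫ v in closedBall (0 : Fin N → ℂ) ρ, ∫ θ in (0 : ℝ)..2 * Real.pi, g (circleMap 0 1 θ • v) := by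
    refine setIntegral_mono_on ?_ ?_ measurableSet_closedBall hpt
    · exact integrableOn_const (isCompact_closedBall _ _).measure_lt_top.ne
    · simp_rw [intervalIntegral.integral_of_le Real.two_pi_pos.le]
      rw [Set.uIoc_of_le Real.two_pi_pos.le] at hint
      exact hint.integral_prod_right
  rw [← hswap, setIntegral_const, smul_eq_mul] at hle
  have h2 : 2 * Real.pi * (volume.real (closedBall (0 : Fin N → ℂ) ρ) * ‖c q‖ ^ p)
      ≤ 2 * Real.pi * ∫ v in closedBall 0 ρ, g v := by linarith
  exact le_of_mul_le_mul_left h2 Real.two_pi_pos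

/-- **Hartogs' lemma** on the growth of sequences of holomorphic functions: pointwise geometric
bounds are locally uniform up to an arbitrarily small loss, if some locally uniform geometric bound
holds. -/
theorem exists_eventually_forall_norm_le_pow {N : ℕ} {c : ℕ → (Fin N → ℂ) → ℂ} {p : Fin N → ℂ}
    {η A B B' : ℝ} (hη : 0 < η) (hA : 0 ≤ A) (hB : 0 ≤ B) (hBB' : B < B')
    (hc : ∀ k, DifferentiableOn ℂ (c k) (ball p η))
    (hcA : ∀ k, 0 < k → ∀ q ∈ ball p η, ‖c k q‖ ≤ A ^ k)
    (hcB : ∀ q ∈ ball p η, ∀ᶠ k in atTop, ‖c k q‖ ≤ B ^ k) :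
    ∃ η' > 0, ∀ᶠ k in atTop, ∀ q ∈ ball p η', ‖c k q‖ ≤ B' ^ k := by
  set v : ℕ → (Fin N → ℂ) → ℝ := fun k q => ‖c k q‖ ^ (1 / k : ℝ) with hv
  have hroot : ∀ k : ℕ, 0 < k → ∀ x D : ℝ, 0 ≤ x → 0 ≤ D → (x ^ (1 / k : ℝ) ≤ D ↔ x ≤ D ^ k) := by
    intro k hk x D hx hD
    have hk' : (0 : ℝ) < k := by exact_mod_cast hk
    rw [one_div, Real.rpow_inv_le_iff_of_pos hx hD hk', Real.rpow_natCast]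
  -- The excess of the `k`-th root over `B` is bounded by `A` and eventually zero at each point, so
  -- its integral tends to `0`; the sub-mean inequality turns this into a uniform bound.
  set w : ℕ → (Fin N → ℂ) → ℝ := fun k q => max (v k q - B) 0 with hw
  have hsub : closedBall p (η / 2) ⊆ ball p η := closedBall_subset_ball (by linarith)
  have hvcont : ∀ k, ContinuousOn (v k) (ball p η) := fun k =>
    ((hc k).continuousOn.norm).rpow_const fun _ _ => Or.inr (by positivity)
  have hwcont : ∀ k, ContinuousOn (w k) (closedBall p (η / 2)) := fun k =>
    (((hvcont k).mono hsub).sub continuousOn_const).sup continuousOn_const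
  have hlim : Tendsto (fun k => ∫ q in closedBall p (η / 2), w k q) atTop (𝓝 0) := by
    have h0 : (0 : ℝ) = ∫ q in closedBall p (η / 2), (0 : ℝ) := by simp
    rw [h0]
    refine tendsto_integral_filter_of_dominated_convergence (fun _ => A) ?_ ?_ ?_ ?_
    · exact Eventually.of_forall fun k =>
        (hwcont k).aestronglyMeasurable measurableSet_closedBall
    · filter_upwards [eventually_gt_atTop 0] with k hk
      refine (ae_restrict_iff' measurableSet_closedBall).2 (Eventually.of_forall fun q hq => ?_)
      rw [Real.norm_of_nonneg (le_max_right _ _)]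
      refine max_le ?_ hA
      have := (hroot k hk _ A (norm_nonneg _) hA).2 (hcA k hk q (hsub hq))
      simp only [hv]
      linarith
    · exact integrableOn_const (isCompact_closedBall _ _).measure_lt_top.ne
    · refine (ae_restrict_iff' measurableSet_closedBall).2 (Eventually.of_forall fun q hq => ?_)
      refine tendsto_const_nhds.congr' ?_
      filter_upwards [hcB q (hsub hq), eventually_gt_atTop 0] with k hk hk0
      have := (hroot k hk0 _ B (norm_nonneg _) hB).2 hk
      exact (max_eq_right (by simp only [hv]; linarith)).symm
  set V := volume.real (closedBall (0 : Fin N → ℂ) (η / 4)) with hV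
  have hVpos : 0 < V := by
    refine ENNReal.toReal_pos (measure_closedBall_pos _ _ (by linarith)).ne'
      (isCompact_closedBall _ _).measure_lt_top.ne
  refine ⟨η / 4, by linarith, ?_⟩
  filter_upwards [hlim.eventually_lt_const (mul_pos (sub_pos.2 hBB') hVpos), eventually_gt_atTop 0]
    with k hk hk0 q hq
  have hq' : dist q p < η / 4 := hq
  have hsub1 : closedBall q (η / 4) ⊆ closedBall p (η / 2) :=
    closedBall_subset_closedBall' (by linarith)
  have hsub2 : ball q (η / 2) ⊆ ball p η := ball_subset_ball' (by linarith)
  have hk0' : (0 : ℝ) < 1 / k := by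
    have : (0 : ℝ) < k := by exact_mod_cast hk0
    positivity
  have h1 := volume_mul_norm_rpow_le_setIntegral (ρ := η / 4) (ρ' := η / 2) (by linarith) hk0'
    ((hc k).mono hsub2)
  have hvol : volume.real (closedBall q (η / 4)) = V := by
    rw [hV, Measure.real, Measure.real, Measure.addHaar_closedBall_center]
  rw [hvol] at h1
  have hwint : IntegrableOn (w k) (closedBall p (η / 2)) :=
    (hwcont k).integrableOn_compact (isCompact_closedBall _ _)
  have hBint : IntegrableOn (fun _ : Fin N → ℂ => B) (closedBall q (η / 4)) :=
    integrableOn_const (isCompact_closedBall _ _).measure_lt_top.ne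
  have h2 : ∫ x in closedBall q (η / 4), v k x ≤ ∫ x in closedBall q (η / 4), (B + w k x) := by
    refine setIntegral_mono_on ?_ ?_ measurableSet_closedBall fun x _ => ?_
    · exact ((hvcont k).mono (hsub1.trans hsub)).integrableOn_compact (isCompact_closedBall _ _)
    · exact hBint.add (hwint.mono_set hsub1)
    · have := le_max_left (v k x - B) 0
      simp only [hw]
      linarith
  rw [integral_add hBint (hwint.mono_set hsub1), setIntegral_const, smul_eq_mul, hvol] at h2
  have h3 : ∫ x in closedBall q (η / 4), w k x ≤ ∫ x in closedBall p (η / 2), w k x :=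
    setIntegral_mono_set hwint (Eventually.of_forall fun x => le_max_right _ _)
      hsub1.eventuallyLE
  refine (hroot k hk0 _ B' (norm_nonneg _) (hB.trans hBB'.le)).1 ?_
  have h4 : V * ‖c k q‖ ^ (1 / k : ℝ) ≤ V * B' := by
    have : V * ‖c k q‖ ^ (1 / k : ℝ) ≤ ∫ x in closedBall q (η / 4), v k x := h1
    linarith
  exact le_of_mul_le_mul_left h4 hVpos

/-! ### Taylor coefficients in time and joint holomorphy -/

/-- The `k`-th Taylor coefficient at `t` of a function of one complex variable. -/
noncomputable def taylorCoeff (f : ℂ → ℂ) (t : ℂ) (k : ℕ) : ℂ :=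
  (k.factorial : ℂ)⁻¹ * iteratedDeriv k f t

theorem hasSum_taylorCoeff {f : ℂ → ℂ} {t : ℂ} {R : ℝ} (hf : DifferentiableOn ℂ f (ball t R))
    {h : ℂ} (hh : ‖h‖ < R) : HasSum (fun k => taylorCoeff f t k * h ^ k) (f (t + h)) := by
  have hz : t + h ∈ ball t R := by simpa [mem_ball, dist_eq_norm] using hh
  have := Complex.hasSum_taylorSeries_on_ball hf hz
  simp only [add_sub_cancel_left, smul_eq_mul] at this
  have e : (fun k => taylorCoeff f t k * h ^ k)
      = fun k => (k.factorial : ℂ)⁻¹ * (h ^ k * iteratedDeriv k f t) := by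
    funext k
    rw [taylorCoeff]
    ring
  rwa [e]

theorem norm_taylorCoeff_le {f : ℂ → ℂ} {t : ℂ} {r R M : ℝ} (hr : 0 < r) (hrR : r < R)
    (hf : DifferentiableOn ℂ f (ball t R)) (hM : ∀ s ∈ closedBall t r, ‖f s‖ ≤ M) (k : ℕ) :
    ‖taylorCoeff f t k‖ ≤ M / r ^ k := by
  have hcl : DiffContOnCl ℂ f (ball t r) := by
    refine DifferentiableOn.diffContOnCl (hf.mono ?_)
    exact closure_ball_subset_closedBall.trans (closedBall_subset_ball hrR)
  have := Complex.norm_iteratedDeriv_le_of_forall_mem_sphere_norm_le k hr hcl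
    fun z hz => hM z (sphere_subset_closedBall hz)
  rw [taylorCoeff, norm_mul, norm_inv, Complex.norm_natCast]
  have hk : (0 : ℝ) < k.factorial := by exact_mod_cast k.factorial_pos
  calc _ ≤ (k.factorial : ℝ)⁻¹ * (k.factorial * M / r ^ k) := by gcongr
    _ = _ := by field_simp

/-- The Taylor quotient `(f (t + h) - ∑_{j < k} c_j h^j) / h^k` approximates `c_k`. -/
theorem norm_taylorQuotient_sub_le {f : ℂ → ℂ} {t : ℂ} {r R M : ℝ} (hr : 0 < r) (hrR : r < R)
    (hf : DifferentiableOn ℂ f (ball t R)) (hM : ∀ s ∈ closedBall t r, ‖f s‖ ≤ M) (k n : ℕ) :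
    ‖(f (t + (r / (n + 2) : ℝ)) - ∑ j ∈ Finset.range k, taylorCoeff f t j * ((r / (n + 2) : ℝ) : ℂ) ^ j)
        / ((r / (n + 2) : ℝ) : ℂ) ^ k - taylorCoeff f t k‖ ≤ M / r ^ k * (1 / (n + 1)) := by
  -- With `h / r = 1 / (n + 2)` the geometric tail sums to exactly `1 / (n + 1)`.
  set h : ℝ := r / (n + 2) with hh
  have hn : (0 : ℝ) < n + 2 := by positivity
  have hh0 : 0 < h := by positivity
  have hh0' : (h : ℂ) ≠ 0 := by exact_mod_cast hh0.ne'
  have hhR : ‖(h : ℂ)‖ < R := by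
    rw [Complex.norm_real, Real.norm_of_nonneg hh0.le]
    refine lt_of_le_of_lt ?_ hrR
    exact div_le_self hr.le (by linarith [(Nat.cast_nonneg n : (0 : ℝ) ≤ n)])
  have h1 := (hasSum_nat_add_iff' k).2 (hasSum_taylorCoeff hf hhR)
  have h2 : HasSum (fun i => taylorCoeff f t (i + k) * (h : ℂ) ^ i)
      ((f (t + h) - ∑ j ∈ Finset.range k, taylorCoeff f t j * (h : ℂ) ^ j) / (h : ℂ) ^ k) := by
    have e : (fun i => taylorCoeff f t (i + k) * (h : ℂ) ^ i)
        = fun i => taylorCoeff f t (i + k) * (h : ℂ) ^ (i + k) / (h : ℂ) ^ k := by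
      funext i
      rw [pow_add]
      field_simp
    rw [e]
    exact h1.div_const ((h : ℂ) ^ k)
  have h3 := (hasSum_nat_add_iff' 1).2 h2
  simp only [Finset.sum_range_one, zero_add, pow_zero, mul_one] at h3
  have hx : 1 / ((n : ℝ) + 2) < 1 := by
    rw [div_lt_one hn]
    linarith [(Nat.cast_nonneg n : (0 : ℝ) ≤ n)]
  have h4 := ((hasSum_geometric_of_lt_one (r := 1 / ((n : ℝ) + 2)) (by positivity) hx).mul_left
    (M / r ^ k * (1 / ((n : ℝ) + 2))))
  have h5 := h3.norm_le_of_bounded h4 fun i => ?_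
  · refine h5.trans (le_of_eq ?_)
    have : (1 - 1 / ((n : ℝ) + 2)) = (n + 1) / (n + 2) := by field_simp; ring
    rw [this]
    field_simp
  · rw [norm_mul, norm_pow, Complex.norm_real, Real.norm_of_nonneg hh0.le]
    calc _ ≤ M / r ^ (i + 1 + k) * h ^ (i + 1) := by
          gcongr
          exact norm_taylorCoeff_le hr hrR hf hM _
      _ = _ := by
          rw [hh, div_pow r, pow_add r (i + 1) k, div_pow, one_pow, pow_succ ((n : ℝ) + 2) i]
          field_simp

/-- By strong induction the Taylor quotients are holomorphic in `q`, and they converge uniformly to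
the next coefficient. -/
theorem differentiableOn_taylorCoeff {E : Type*} [NormedAddCommGroup E] [NormedSpace ℂ E]
    {u : ℂ → E → ℂ} {t : ℂ} {s : Set E} {r M : ℝ} (hr : 0 < r) (hs : IsOpen s)
    (hsep : ∀ q ∈ s, DifferentiableOn ℂ (fun τ => u τ q) (ball t r))
    (hjoint : ∀ τ ∈ ball t r, DifferentiableOn ℂ (u τ) s)
    (hM : ∀ τ ∈ ball t r, ∀ q ∈ s, ‖u τ q‖ ≤ M) (k : ℕ) :
    DifferentiableOn ℂ (fun q => taylorCoeff (fun τ => u τ q) t k) s := by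
  induction k using Nat.strong_induction_on with
  | _ k ih =>
  set ρ := r / 2 with hρ
  have hρ0 : 0 < ρ := by positivity
  have hρr : ρ < r := by linarith
  have hsub : closedBall t ρ ⊆ ball t r := closedBall_subset_ball hρr
  have hmem : ∀ n : ℕ, t + ((ρ / (n + 2) : ℝ) : ℂ) ∈ ball t r := by
    intro n
    have hn : (0 : ℝ) < n + 2 := by positivity
    rw [mem_ball, dist_eq_norm, add_sub_cancel_left, Complex.norm_real,
      Real.norm_of_nonneg (by positivity)]
    refine lt_of_le_of_lt ?_ hρr
    exact div_le_self hρ0.le (by linarith [(Nat.cast_nonneg n : (0 : ℝ) ≤ n)])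
  refine TendstoUniformlyOn.differentiableOn_of_complex
    (f := fun n q => (u (t + (ρ / ((n : ℝ) + 2) : ℝ)) q - ∑ j ∈ Finset.range k,
      taylorCoeff (fun τ => u τ q) t j * ((ρ / ((n : ℝ) + 2) : ℝ) : ℂ) ^ j)
        / ((ρ / ((n : ℝ) + 2) : ℝ) : ℂ) ^ k) hs (fun n => ?_) ?_
  · refine DifferentiableOn.congr (((hjoint _ (hmem n)).fun_sub ?_).mul_const
      (((ρ / ((n : ℝ) + 2) : ℝ) : ℂ) ^ k)⁻¹) fun q _ => div_eq_mul_inv _ _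
    exact DifferentiableOn.fun_sum fun j hj => (ih j (Finset.mem_range.1 hj)).mul_const _
  · rw [Metric.tendstoUniformlyOn_iff]
    intro ε hε
    have ht : Tendsto (fun n : ℕ => M / ρ ^ k * (1 / ((n : ℝ) + 1))) atTop (𝓝 (M / ρ ^ k * 0)) :=
      tendsto_one_div_add_atTop_nhds_zero_nat.const_mul _
    rw [mul_zero] at ht
    filter_upwards [ht.eventually_lt_const hε] with n hn q hq
    rw [dist_comm, dist_eq_norm]
    exact (norm_taylorQuotient_sub_le hρ0 hρr (hsep q hq) (fun τ hτ => hM τ (hsub hτ) q hq)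
      k n).trans_lt hn

/-- **Hartogs' extension of joint holomorphy**: let `u τ q` be holomorphic in `τ` on a large disc
for every `q`, and jointly holomorphic and bounded for `τ` in a smaller concentric disc. Then
`u τ` is holomorphic near the centre of the ball of `q`, for every `τ` of the large disc. -/
theorem exists_differentiableOn_of_separately {N : ℕ} {u : ℂ → (Fin N → ℂ) → ℂ} {t : ℂ}
    {p : Fin N → ℂ} {r R η M : ℝ} (hr : 0 < r) (hη : 0 < η)
    (hsep : ∀ q ∈ ball p η, DifferentiableOn ℂ (fun τ => u τ q) (ball t R))
    (hjoint : ∀ τ ∈ ball t r, DifferentiableOn ℂ (u τ) (ball p η))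
    (hM : ∀ τ ∈ ball t r, ∀ q ∈ ball p η, ‖u τ q‖ ≤ M) {τ : ℂ} (hτ : τ ∈ ball t R) :
    ∃ η' > 0, DifferentiableOn ℂ (u τ) (ball p η') := by
  have hR : 0 < R := pos_of_mem_ball hτ
  set c : ℕ → (Fin N → ℂ) → ℂ := fun k q => taylorCoeff (fun τ => u τ q) t k with hc
  set r₀ := min r R with hr₀
  have hr₀0 : 0 < r₀ := lt_min hr hR
  have hb1 : ball t r₀ ⊆ ball t r := ball_subset_ball (min_le_left _ _)
  have hb2 : ball t r₀ ⊆ ball t R := ball_subset_ball (min_le_right _ _)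
  have hcd : ∀ k, DifferentiableOn ℂ (c k) (ball p η) := fun k =>
    differentiableOn_taylorCoeff hr₀0 isOpen_ball (fun q hq => (hsep q hq).mono hb2)
      (fun s hs => hjoint s (hb1 hs)) (fun s hs => hM s (hb1 hs)) k
  set A : ℝ := max M 1 / (r₀ / 2) with hA
  have hA0 : 0 ≤ A := by positivity
  have hcA : ∀ k, 0 < k → ∀ q ∈ ball p η, ‖c k q‖ ≤ A ^ k := by
    intro k hk q hq
    refine (norm_taylorCoeff_le (r := r₀ / 2) (R := r₀) (M := M) (by positivity) (by linarith)
      ((hsep q hq).mono hb2) (fun s hs => hM s (hb1 (closedBall_subset_ball (by linarith) hs)) q hq)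
      k).trans ?_
    rw [hA, div_pow (max M 1)]
    gcongr
    calc M ≤ max M 1 := le_max_left _ _
      _ ≤ max M 1 ^ k := le_self_pow₀ (le_max_right _ _) hk.ne'
  set h := τ - t with hh
  have hhR : ‖h‖ < R := by rwa [mem_ball, dist_eq_norm] at hτ
  -- Each of the three radii absorbs one loss: the constant depending on `q` costs `R₁` to `R₂`,
  -- Hartogs' lemma costs `R₂` to `R₃`, and `‖h‖ < R₃` makes the series converge uniformly.
  obtain ⟨R₃, hR₃h, hR₃⟩ := exists_between hhR
  obtain ⟨R₂, hR₂3, hR₂⟩ := exists_between hR₃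
  obtain ⟨R₁, hR₁2, hR₁⟩ := exists_between hR₂
  have hR₃0 : 0 < R₃ := (norm_nonneg _).trans_lt hR₃h
  have hR₂0 : 0 < R₂ := hR₃0.trans hR₂3
  have hR₁0 : 0 < R₁ := hR₂0.trans hR₁2
  have hcB : ∀ q ∈ ball p η, ∀ᶠ k in atTop, ‖c k q‖ ≤ (1 / R₂) ^ k := by
    intro q hq
    obtain ⟨C, hC⟩ := (isCompact_closedBall t R₁).exists_bound_of_continuousOn
      ((hsep q hq).continuousOn.mono (closedBall_subset_ball hR₁))
    have hlim : Tendsto (fun k : ℕ => C * (R₂ / R₁) ^ k) atTop (𝓝 (C * 0)) :=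
      (tendsto_pow_atTop_nhds_zero_of_lt_one (by positivity) ((div_lt_one hR₁0).2 hR₁2)).const_mul C
    rw [mul_zero] at hlim
    filter_upwards [hlim.eventually_le_const one_pos] with k hk
    have hle : ‖c k q‖ ≤ C / R₁ ^ k := norm_taylorCoeff_le hR₁0 hR₁ (hsep q hq) hC k
    refine hle.trans ?_
    rw [div_pow, one_pow, div_le_div_iff₀ (by positivity) (by positivity), one_mul]
    rw [div_pow, ← mul_div_assoc, div_le_one (by positivity)] at hk
    exact hk
  obtain ⟨η₁, hη₁, hev⟩ := exists_eventually_forall_norm_le_pow (B' := 1 / R₃) hη hA0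
    (by positivity) (one_div_lt_one_div_of_lt hR₃0 hR₂3) hcd hcA hcB
  refine ⟨min η η₁, lt_min hη hη₁, ?_⟩
  have hsub : ball p (min η η₁) ⊆ ball p η := ball_subset_ball (min_le_left _ _)
  have hsub1 : ball p (min η η₁) ⊆ ball p η₁ := ball_subset_ball (min_le_right _ _)
  have hunif : TendstoUniformlyOn (fun n q => ∑ k ∈ Finset.range n, c k q * h ^ k)
      (fun q => ∑' k, c k q * h ^ k) atTop (ball p (min η η₁)) := by
    refine tendstoUniformlyOn_tsum_nat_eventually (u := fun k => (‖h‖ / R₃) ^ k)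
      (summable_geometric_of_lt_one (by positivity) ((div_lt_one hR₃0).2 hR₃h)) ?_
    filter_upwards [hev] with k hk q hq
    rw [norm_mul, norm_pow]
    calc _ ≤ (1 / R₃) ^ k * ‖h‖ ^ k := by
          gcongr
          exact hk q (hsub1 hq)
      _ = _ := by rw [← mul_pow]; ring
  refine (hunif.differentiableOn_of_complex isOpen_ball fun n => ?_).congr fun q hq => ?_
  · exact DifferentiableOn.fun_sum fun k _ => ((hcd k).mono hsub).mul_const _
  · have := (hasSum_taylorCoeff (hsep q (hsub hq)) hhR).tsum_eq
    rw [this, hh, add_sub_cancel]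

/-! ### Vector fields and integral curves in charts -/

namespace FHol

variable {N : ℕ} {M : Type*} [TopologicalSpace M] [ChartedSpace (CN N) M]

/-- The expression of a vector field in a chart. -/
noncomputable def localField (F : (z : M) → TangentSpace 𝓘(ℂ, CN N) z)
    (e : OpenPartialHomeomorph M (CN N)) (x : CN N) : CN N :=
  mfderiv 𝓘(ℂ, CN N) 𝓘(ℂ, CN N) e (e.symm x) (F (e.symm x))

variable {F : (z : M) → TangentSpace 𝓘(ℂ, CN N) z}
  {e : OpenPartialHomeomorph M (CN N)}

theorem hasDerivAt_of_hasFDerivAt_comp_smulRight {f : ℂ → CN N} {L : CN N →L[ℂ] CN N} {v : CN N}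
    {z : ℂ} (h : HasFDerivAt f (L.comp ((1 : ℂ →L[ℂ] ℂ).smulRight v)) z) :
    HasDerivAt f (L v) z := by
  simpa using h.hasDerivAt

theorem mdifferentiableAt_chart (he : e ∈ IsManifold.maximalAtlas 𝓘(ℂ, CN N) ω M) {z : M}
    (hz : z ∈ e.source) : MDifferentiableAt 𝓘(ℂ, CN N) 𝓘(ℂ, CN N) e z :=
  (contMDiffAt_of_mem_maximalAtlas he hz).mdifferentiableAt (by simp)

theorem mdifferentiableAt_chart_symm (he : e ∈ IsManifold.maximalAtlas 𝓘(ℂ, CN N) ω M) {x : CN N}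
    (hx : x ∈ e.target) : MDifferentiableAt 𝓘(ℂ, CN N) 𝓘(ℂ, CN N) e.symm x :=
  (contMDiffAt_symm_of_mem_maximalAtlas he hx).mdifferentiableAt (by simp)

theorem IsIntegralCurveOn.hasDerivAt_chart (he : e ∈ IsManifold.maximalAtlas 𝓘(ℂ, CN N) ω M)
    {γ : ℂ → M} {U : Set ℂ} (hγ : IsIntegralCurveOn F γ U) {ζ : ℂ} (hζ : ζ ∈ U)
    (hγζ : γ ζ ∈ e.source) :
    HasDerivAt (fun ζ => e (γ ζ)) (localField F e (e (γ ζ))) ζ := by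
  have h1 := (mdifferentiableAt_chart he hγζ).hasMFDerivAt.comp ζ (hγ.2 ζ hζ)
  rw [localField, e.left_inv hγζ]
  exact hasDerivAt_of_hasFDerivAt_comp_smulRight (hasMFDerivAt_iff_hasFDerivAt.1 h1)

theorem mfderiv_chart_symm_localField (he : e ∈ IsManifold.maximalAtlas 𝓘(ℂ, CN N) ω M) {x : CN N}
    (hx : x ∈ e.target) :
    mfderiv 𝓘(ℂ, CN N) 𝓘(ℂ, CN N) e.symm x (localField F e x) = F (e.symm x) := by
  have hz : e.symm x ∈ e.source := e.map_target hx
  have h1 := (mdifferentiableAt_chart he hz).hasMFDerivAt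
  have h2 := (mdifferentiableAt_chart_symm he hx).hasMFDerivAt
  rw [← e.right_inv hx] at h2
  have h3 := h2.comp (e.symm x) h1
  have h4 : HasMFDerivAt 𝓘(ℂ, CN N) 𝓘(ℂ, CN N) (e.symm ∘ e) (e.symm x)
      (ContinuousLinearMap.id ℂ (TangentSpace 𝓘(ℂ, CN N) (e.symm x))) :=
    (hasMFDerivAt_id _).congr_of_eventuallyEq (e.eventually_left_inverse hz)
  have h5 := hasMFDerivAt_unique h3 h4
  have h6 := congrArg (fun L : TangentSpace 𝓘(ℂ, CN N) (e.symm x) →L[ℂ]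
    TangentSpace 𝓘(ℂ, CN N) (e.symm x) => L (F (e.symm x))) h5
  rw [e.right_inv hx] at h6
  exact h6

theorem isIntegralCurveOn_chart_symm (he : e ∈ IsManifold.maximalAtlas 𝓘(ℂ, CN N) ω M)
    {x : ℂ → CN N} {U : Set ℂ} (hU : IsOpen U)
    (hx : ∀ ζ ∈ U, x ζ ∈ e.target ∧ HasDerivAt x (localField F e (x ζ)) ζ) :
    IsIntegralCurveOn F (fun ζ => e.symm (x ζ)) U := by
  refine ⟨hU, fun ζ hζ => ?_⟩
  obtain ⟨h1, h2⟩ := hx ζ hζ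
  have h3 := (mdifferentiableAt_chart_symm he h1).hasMFDerivAt.comp ζ
    (hasMFDerivAt_iff_hasFDerivAt.2 h2.hasFDerivAt)
  refine h3.congr_mfderiv ?_
  refine ContinuousLinearMap.ext_ring ?_
  have e1 : ContinuousLinearMap.toSpanSingleton ℂ (localField F e (x ζ)) 1
      = localField F e (x ζ) := by simp
  have e2 := mfderiv_chart_symm_localField (F := F) he h1
  exact ((congrArg (mfderiv 𝓘(ℂ, CN N) 𝓘(ℂ, CN N) e.symm (x ζ)) e1).trans e2).trans
    (one_smul ℂ (F (e.symm (x ζ)) : CN N)).symm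

/-- The local expression is the fibre component of the tangent map of the chart applied to the
section `F`, a composition of smooth maps. -/
theorem contDiffOn_localField [IsManifold 𝓘(ℂ, CN N) ω M] (hF : IsHolomorphicField F)
    (he : e ∈ IsManifold.maximalAtlas 𝓘(ℂ, CN N) ω M) :
    ContDiffOn ℂ 1 (localField F e) e.target := by
  have h1 : ContMDiffOn 𝓘(ℂ, CN N).tangent 𝓘(ℂ, CN N).tangent 1
      (tangentMapWithin 𝓘(ℂ, CN N) 𝓘(ℂ, CN N) e e.source) _ :=
    ContMDiffOn.contMDiffOn_tangentMapWithin (n := ω) (contMDiffOn_of_mem_maximalAtlas he) le_top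
      e.open_source.uniqueMDiffOn
  have h2 : ContMDiffOn 𝓘(ℂ, CN N) 𝓘(ℂ, CN N).tangent 1
      (fun x => (⟨e.symm x, F (e.symm x)⟩ : TangentBundle 𝓘(ℂ, CN N) M)) e.target :=
    (hF.of_le le_top).comp_contMDiffOn
      ((contMDiffOn_symm_of_mem_maximalAtlas he).of_le le_top)
  have h3 := (contMDiff_snd_tangentBundle_modelSpace (CN N) 𝓘(ℂ, CN N)).comp_contMDiffOn
    (h1.comp h2 fun x hx => e.map_target hx)
  refine (contMDiffOn_iff_contDiffOn.1 h3).congr fun x hx => ?_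
  have hz : e.symm x ∈ e.source := e.map_target hx
  change _ = mfderivWithin 𝓘(ℂ, CN N) 𝓘(ℂ, CN N) e e.source (e.symm x) (F (e.symm x))
  rw [mfderivWithin_of_mem_nhds (e.open_source.mem_nhds hz)]
  rfl

end FHol

/-! ### Propagation of holomorphy along leaves -/

namespace FHol

variable {N : ℕ} {M : Type*} [TopologicalSpace M] [ChartedSpace (CN N) M]
  {F : (z : M) → TangentSpace 𝓘(ℂ, CN N) z} {e : OpenPartialHomeomorph M (CN N)} {φ : M → ℂ}

theorem OnCommonCurve.symm {p q : M} (h : OnCommonCurve F p q) : OnCommonCurve F q p := by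
  obtain ⟨γ, U, hγ, hU, hp, hq⟩ := h
  exact ⟨γ, U, hγ, hU, hq, hp⟩

instance stdSymm_onCommonCurve : Std.Symm (OnCommonCurve F) := ⟨fun _ _ => OnCommonCurve.symm⟩

theorem mem_leaf_symm {p q : M} (h : q ∈ leaf F p) : p ∈ leaf F q :=
  Relation.ReflTransGen.stdSymm.symm _ _ h

theorem mem_leaf_trans {p q r : M} (h : q ∈ leaf F p) (h' : r ∈ leaf F q) : r ∈ leaf F p :=
  Relation.ReflTransGen.trans h h'

theorem mem_sat_of_onCommonCurve {z₀ p q : M} (h : OnCommonCurve F p q) (hq : q ∈ Sat F z₀) :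
    p ∈ Sat F z₀ := by
  obtain ⟨L, ⟨⟨a, rfl⟩, hL⟩, hqL⟩ := hq
  exact ⟨leaf F a, ⟨⟨a, rfl⟩, hL⟩, mem_leaf_trans hqL (Relation.ReflTransGen.single h.symm)⟩

theorem IsFHolomorphic.differentiableOn_chart (hφ : IsFHolomorphic F φ)
    (he : e ∈ IsManifold.maximalAtlas 𝓘(ℂ, CN N) ω M)
    {x : ℂ → CN N} {U : Set ℂ} (hU : IsOpen U)
    (hx : ∀ ζ ∈ U, x ζ ∈ e.target ∧ HasDerivAt x (localField F e (x ζ)) ζ) :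
    DifferentiableOn ℂ (fun ζ => φ (e.symm (x ζ))) U :=
  hφ _ _ (isIntegralCurveOn_chart_symm he hU hx)

theorem mdifferentiableAt_of_chart (he : e ∈ IsManifold.maximalAtlas 𝓘(ℂ, CN N) ω M)
    {x : CN N} (hx : x ∈ e.target) (h : DifferentiableAt ℂ (fun x => φ (e.symm x)) x) :
    MDifferentiableAt 𝓘(ℂ, CN N) 𝓘(ℂ, ℂ) φ (e.symm x) := by
  have hz : e.symm x ∈ e.source := e.map_target hx
  have h1 : MDifferentiableAt 𝓘(ℂ, CN N) 𝓘(ℂ, ℂ) (fun x => φ (e.symm x)) (e (e.symm x)) := by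
    rw [e.right_inv hx]
    exact h.mdifferentiableAt
  refine (h1.comp (e.symm x) (mdifferentiableAt_chart he hz)).congr_of_eventuallyEq ?_
  filter_upwards [e.eventually_left_inverse hz] with z hz
  simp [hz]

theorem differentiableAt_chart (he : e ∈ IsManifold.maximalAtlas 𝓘(ℂ, CN N) ω M)
    {x : CN N} (hx : x ∈ e.target) (h : MDifferentiableAt 𝓘(ℂ, CN N) 𝓘(ℂ, ℂ) φ (e.symm x)) :
    DifferentiableAt ℂ (fun x => φ (e.symm x)) x :=
  (h.comp x (mdifferentiableAt_chart_symm he hx)).differentiableAt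

/-- The set of points near which `φ` is holomorphic and which are interior to `S`. -/
def regularSet (S : Set M) (φ : M → ℂ) : Set M :=
  {p | ∀ᶠ q in 𝓝 p, q ∈ S ∧ MDifferentiableAt 𝓘(ℂ, CN N) 𝓘(ℂ, ℂ) φ q}

theorem isOpen_regularSet (S : Set M) (φ : M → ℂ) : IsOpen (regularSet (N := N) S φ) :=
  isOpen_setOfPred_eventually_nhds

/-- In flow coordinates `φ` is holomorphic in time for every starting point, and jointly holomorphic
and bounded near `(t, x₀)`. Hartogs' extension carries holomorphy in the starting point to time `0`,
where the flow is the identity. -/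
theorem eventually_mdifferentiableAt_of_flow (hφ : IsFHolomorphic F φ)
    (he : e ∈ IsManifold.maximalAtlas 𝓘(ℂ, CN N) ω M) {S : Set M}
    (hS : ∀ p q, OnCommonCurve F p q → q ∈ S → p ∈ S) {Ψ : ℂ → CN N → CN N} {x₀ : CN N}
    {δ R : ℝ} (hδ : 0 < δ) (hR : 0 < R) (hx₀t : x₀ ∈ e.target)
    (hΨd : DifferentiableOn ℂ (fun x : ℂ × CN N => Ψ x.1 x.2) (ball 0 δ ×ˢ ball x₀ R))
    (hcurve : ∀ q ∈ ball x₀ R, ∀ s ∈ ball (0 : ℂ) δ,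
      Ψ s q ∈ e.target ∧ HasDerivAt (fun s => Ψ s q) (localField F e (Ψ s q)) s)
    (hΨ0 : ∀ q ∈ ball x₀ R, Ψ 0 q = q) {t : ℂ} (ht2 : ‖t‖ < δ / 2)
    (hreg : e.symm (Ψ t x₀) ∈ regularSet (N := N) S φ) :
    ∀ᶠ x in 𝓝 x₀, e.symm x ∈ S ∧ MDifferentiableAt 𝓘(ℂ, CN N) 𝓘(ℂ, ℂ) φ (e.symm x) := by
  have ht0 : t ∈ ball (0 : ℂ) δ := by
    rw [mem_ball_zero_iff]
    linarith
  have hcommon : ∀ q ∈ ball x₀ R, OnCommonCurve F (e.symm q) (e.symm (Ψ t q)) := by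
    intro q hq
    refine ⟨fun s => e.symm (Ψ s q), ball 0 δ,
      isIntegralCurveOn_chart_symm he isOpen_ball (hcurve q hq),
      (convex_ball (0 : ℂ) δ).isPreconnected, ⟨0, mem_ball_self hδ, ?_⟩, ⟨t, ht0, rfl⟩⟩
    simp only [hΨ0 q hq]
  have hx₀R : x₀ ∈ ball x₀ R := mem_ball_self hR
  have hopen : IsOpen (ball (0 : ℂ) δ ×ˢ ball x₀ R) := isOpen_ball.prod isOpen_ball
  have hΨd' : ∀ s ∈ ball (0 : ℂ) δ, ∀ q ∈ ball x₀ R,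
      DifferentiableAt ℂ (fun x : ℂ × CN N => Ψ x.1 x.2) (s, q) := fun s hs q hq =>
    hΨd.differentiableAt (hopen.mem_nhds (mk_mem_prod hs hq))
  have hcont : ContinuousAt (fun x : ℂ × CN N => e.symm (Ψ x.1 x.2)) (t, x₀) :=
    ContinuousAt.comp (f := fun x : ℂ × CN N => Ψ x.1 x.2) (g := e.symm)
      (e.continuousAt_symm (hcurve x₀ hx₀R t ht0).1) (hΨd' t ht0 x₀ hx₀R).continuousAt
  have hev1 : ∀ᶠ x : ℂ × CN N in 𝓝 (t, x₀), e.symm (Ψ x.1 x.2) ∈ regularSet (N := N) S φ :=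
    hcont.eventually_mem ((isOpen_regularSet S φ).mem_nhds hreg)
  have hev2 : ∀ᶠ x : ℂ × CN N in 𝓝 (t, x₀),
      ‖φ (e.symm (Ψ x.1 x.2))‖ < ‖φ (e.symm (Ψ t x₀))‖ + 1 := by
    have hφc : ContinuousAt φ (e.symm (Ψ t x₀)) := (Eventually.self_of_nhds hreg).2.continuousAt
    have : ContinuousAt (fun x : ℂ × CN N => ‖φ (e.symm (Ψ x.1 x.2))‖) (t, x₀) :=
      (ContinuousAt.comp (f := fun x : ℂ × CN N => e.symm (Ψ x.1 x.2)) (g := φ) hφc hcont).norm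
    exact this.eventually_lt_const (lt_add_one _)
  have hev := (hev1.and hev2).and (hopen.mem_nhds (mk_mem_prod ht0 hx₀R))
  obtain ⟨r, hr, hrb⟩ := Metric.eventually_nhds_iff_ball.1 hev
  have hprod : ∀ s ∈ ball t r, ∀ q ∈ ball x₀ r, (s, q) ∈ ball (t, x₀) r := by
    intro s hs q hq
    rw [← ball_prod_same]
    exact mk_mem_prod hs hq
  -- Because `‖t‖ < δ / 2`, the disc of radius `δ / 2` about `t` contains `0` and still lies in the
  -- domain of the flow.
  have hbt : ball t (δ / 2) ⊆ ball 0 δ := ball_subset_ball' (by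
    rw [dist_zero_right]
    linarith)
  have hqR : ∀ q ∈ ball x₀ r, q ∈ ball x₀ R := fun q hq =>
    (hrb _ (hprod t (mem_ball_self hr) q hq)).2.2
  have hsδ : ∀ s ∈ ball t r, s ∈ ball (0 : ℂ) δ := fun s hs =>
    (hrb _ (hprod s hs x₀ (mem_ball_self hr))).2.1
  have hsep : ∀ q ∈ ball x₀ r, DifferentiableOn ℂ (fun s => φ (e.symm (Ψ s q)))
      (ball t (δ / 2)) := fun q hq =>
    (hφ.differentiableOn_chart he isOpen_ball (hcurve q (hqR q hq))).mono hbt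
  have hjoint : ∀ s ∈ ball t r, DifferentiableOn ℂ (fun q => φ (e.symm (Ψ s q)))
      (ball x₀ r) := by
    intro s hs q hq
    have h4 := (Eventually.self_of_nhds (hrb _ (hprod s hs q hq)).1.1).2
    have h5 := differentiableAt_chart he (hcurve q (hqR q hq) s (hsδ s hs)).1 h4
    have h6 : DifferentiableAt ℂ (fun q => Ψ s q) q :=
      (hΨd' s (hsδ s hs) q (hqR q hq)).comp (f := fun q : CN N => (s, q)) q
        ((differentiableAt_const s).prodMk differentiableAt_id)
    exact (h5.comp (f := fun q => Ψ s q) q h6).differentiableWithinAt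
  obtain ⟨η, hη, hd⟩ := exists_differentiableOn_of_separately
    (u := fun s q => φ (e.symm (Ψ s q))) hr hr hsep hjoint
    (fun s hs q hq => (hrb _ (hprod s hs q hq)).1.2.le)
    (τ := 0) (by rwa [mem_ball, dist_zero_left])
  filter_upwards [ball_mem_nhds x₀ hη, ball_mem_nhds x₀ hr,
    eventually_mem_nhds_iff.2 (ball_mem_nhds x₀ hR), e.open_target.mem_nhds hx₀t]
    with q hqη hqr hqR' hqt
  refine ⟨hS _ _ (hcommon q (hqR q hqr)) ?_, mdifferentiableAt_of_chart he hqt ?_⟩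
  · exact (Eventually.self_of_nhds (hrb _ (hprod t (mem_ball_self hr) q hqr)).1.1).1
  · refine (hd.differentiableAt (isOpen_ball.mem_nhds hqη)).congr_of_eventuallyEq ?_
    filter_upwards [hqR'] with q' hq'
    simp only [hΨ0 q' hq']

variable [IsManifold 𝓘(ℂ, CN N) ω M]

/-- Regular times are closed along an integral curve: the limit point is joined by the local flow to
a regular point at a time below half the flow radius. -/
theorem mem_regularSet_of_mem_closure (hF : IsHolomorphicField F) (hφ : IsFHolomorphic F φ)
    {S : Set M} (hS : ∀ p q, OnCommonCurve F p q → q ∈ S → p ∈ S) {γ : ℂ → M} {U : Set ℂ}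
    (hγ : IsIntegralCurveOn F γ U) {ζ₀ : ℂ} (hζ₀ : ζ₀ ∈ U)
    (hcl : ∃ᶠ ζ in 𝓝 ζ₀, γ ζ ∈ regularSet (N := N) S φ) : γ ζ₀ ∈ regularSet (N := N) S φ := by
  obtain ⟨e, he, hpe⟩ : ∃ e ∈ IsManifold.maximalAtlas 𝓘(ℂ, CN N) ω M, γ ζ₀ ∈ e.source :=
    ⟨_, IsManifold.chart_mem_maximalAtlas _, mem_chart_source (CN N) _⟩
  have hx₀t : e (γ ζ₀) ∈ e.target := e.map_source hpe
  have hFe := contDiffOn_localField hF he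
  obtain ⟨R, δ, L, K, hRt, hbox⟩ := exists_isFlowBox (e.open_target.mem_nhds hx₀t)
    (hFe.differentiableOn one_ne_zero) (hFe.contDiffAt (e.open_target.mem_nhds hx₀t))
  have hγc : ContinuousAt γ ζ₀ := (hγ.2 ζ₀ hζ₀).continuousAt
  have hsrc : ∀ᶠ ζ in 𝓝 ζ₀, γ ζ ∈ e.source := hγc.eventually_mem (e.open_source.mem_nhds hpe)
  have hode : ∀ᶠ ζ in 𝓝 ζ₀, HasDerivAt (fun ζ => e (γ ζ)) (localField F e (e (γ ζ))) ζ := by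
    filter_upwards [hsrc, hγ.1.mem_nhds hζ₀] with ζ h1 h2
    exact hγ.hasDerivAt_chart he h2 h1
  have hflow := hbox.eventually_eq_localFlow (x := fun ζ => e (γ ζ)) rfl hode
  obtain ⟨ζ₁, hreg, h1, h2, h3⟩ := (hcl.and_eventually (hsrc.and (hflow.and
    (ball_mem_nhds ζ₀ (half_pos hbox.δ_pos))))).exists
  have ht2 : ‖ζ₁ - ζ₀‖ < δ / 2 := by
    rw [← dist_eq_norm]
    exact h3
  have hγζ₁ : e.symm (localFlow (localField F e) (ζ₁ - ζ₀) (e (γ ζ₀))) = γ ζ₁ := by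
    rw [← h2, e.left_inv h1]
  rw [← hγζ₁] at hreg
  have hfin := eventually_mdifferentiableAt_of_flow hφ he hS hbox.δ_pos (half_pos hbox.R_pos) hx₀t
    hbox.differentiableOn_localFlow
    (fun q hq s hs => ⟨hRt (hbox.localFlow_mem hs hq), hbox.hasDerivAt_localFlow hs hq⟩)
    (fun q hq => hbox.localFlow_zero hq) ht2 hreg
  have hfin' := (e.continuousAt hpe).eventually hfin
  filter_upwards [hfin', e.eventually_left_inverse hpe] with y hy hy'
  rwa [hy'] at hy

theorem mem_regularSet_of_mem_leaf (hF : IsHolomorphicField F) (hφ : IsFHolomorphic F φ)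
    {S : Set M} (hS : ∀ p q, OnCommonCurve F p q → q ∈ S → p ∈ S) {p q : M} (hq : q ∈ leaf F p)
    (hp : p ∈ regularSet (N := N) S φ) : q ∈ regularSet (N := N) S φ := by
  induction hq with
  | refl => exact hp
  | tail _ hab ih =>
    obtain ⟨γ, U, hγ, hU, ⟨ζ, hζ, rfl⟩, ⟨ζ', hζ', rfl⟩⟩ := hab
    have hcont : ContinuousOn γ U := fun ζ hζ => (hγ.2 ζ hζ).continuousAt.continuousWithinAt
    have hopen : IsOpen (U ∩ γ ⁻¹' regularSet (N := N) S φ) :=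
      hcont.isOpen_inter_preimage hγ.1 (isOpen_regularSet S φ)
    have hsub := hU.subset_of_closure_inter_subset hopen ⟨ζ, hζ, hζ, ih⟩ (by
      rintro ξ ⟨hξc, hξ⟩
      exact ⟨hξ, mem_regularSet_of_mem_closure hF hφ hS hγ hξ
        ((mem_closure_iff_frequently.1 hξc).mono fun _ h => h.2)⟩)
    exact (hsub hζ').2

end FHol

/-! ### The diagonal linear field at the critical point -/

/-- The reparametrization `-(c * ζ)` converts the contracting flow into integral curves of `x_j ↦ c
r_j x_j`. -/
theorem hasDerivAt_diagFlow {N : ℕ} (r : Fin N → ℝ) (c : ℂ) (w : Fin N → ℂ) (ζ : ℂ) :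
    HasDerivAt (fun ζ => diagFlow r (-(c * ζ)) w)
      (fun j => c * r j * diagFlow r (-(c * ζ)) w j) ζ := by
  refine hasDerivAt_pi.2 fun j => ?_
  have h1 : HasDerivAt (fun ζ : ℂ => -((r j : ℂ) * -(c * ζ))) (c * r j) ζ := by
    have := (hasDerivAt_id ζ).const_mul (c * r j : ℂ)
    refine (this.congr_of_eventuallyEq (Eventually.of_forall fun z => ?_)).congr_deriv (mul_one _)
    simp only [id]
    ring
  refine (h1.cexp.mul_const (w j)).congr_deriv ?_
  simp only [diagFlow]
  ring

theorem diagFlow_add {N : ℕ} (r : Fin N → ℝ) (s t : ℂ) (w : Fin N → ℂ) :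
    diagFlow r s (diagFlow r t w) = diagFlow r (s + t) w := by
  funext j
  simp only [diagFlow]
  rw [← mul_assoc, ← Complex.exp_add]
  ring_nf

theorem continuous_diagFlow {N : ℕ} (r : Fin N → ℝ) (s : ℂ) : Continuous (diagFlow r s) :=
  continuous_pi fun j => continuous_const.mul (continuous_apply j)

theorem tendsto_diagFlow_natCast {N : ℕ} {r : Fin N → ℝ} {ρ : ℝ} (hρ : 0 < ρ) (hr : ∀ j, ρ ≤ r j)
    (w : Fin N → ℂ) : Tendsto (fun n : ℕ => diagFlow r (n + 1 : ℂ) w) atTop (𝓝 0) := by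
  refine squeeze_zero_norm (a := fun n : ℕ => Real.exp (-(ρ * (n + 1))) * ‖w‖) (fun n => ?_) ?_
  · have := norm_diagFlow_le hr (ζ := (n + 1 : ℂ)) (by simp; positivity) w
    simpa using this
  · have h1 : Tendsto (fun n : ℕ => ρ * ((n : ℝ) + 1)) atTop atTop :=
      (tendsto_atTop_add_const_right _ _ tendsto_natCast_atTop_atTop).const_mul_atTop hρ
    have h2 := (Real.tendsto_exp_neg_atTop_nhds_zero.comp h1).mul_const ‖w‖
    simpa using h2

/-- Eigenvalues with positive real ratios are positive multiples of one nonzero number. -/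
theorem exists_eq_mul_ofReal {N : ℕ} {d : Fin N → ℂ}
    (h : ∀ i j, ∃ r : ℝ, 0 < r ∧ d i / d j = r) :
    ∃ c : ℂ, c ≠ 0 ∧ ∃ r : Fin N → ℝ, (∀ j, d j = c * r j) ∧ ∃ ρ > 0, ∀ j, ρ ≤ r j := by
  rcases isEmpty_or_nonempty (Fin N) with hN | ⟨⟨i⟩⟩
  · exact ⟨1, one_ne_zero, fun _ => 1, fun j => hN.elim j, 1, one_pos, fun j => hN.elim j⟩
  · choose r hr0 hr using fun j => h j i
    -- The ratio of `d i` to itself is assumed positive, while division by zero would make it `0`.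
    have hi : d i ≠ 0 := by
      intro hi
      have := hr i
      rw [hi, div_zero] at this
      exact (hr0 i).ne' (by exact_mod_cast this.symm)
    have : Nonempty (Fin N) := ⟨i⟩
    obtain ⟨k, hk⟩ := Finite.exists_min r
    refine ⟨d i, hi, r, fun j => ?_, r k, hr0 k, hk⟩
    rw [← hr j]
    field_simp

namespace FHol

variable {N : ℕ} {M : Type*} [TopologicalSpace M] [ChartedSpace (CN N) M]
  {F : (z : M) → TangentSpace 𝓘(ℂ, CN N) z} {e : OpenPartialHomeomorph M (CN N)} {φ : M → ℂ}

theorem IsFHolomorphic.differentiableOn_diagFlow (hφ : IsFHolomorphic F φ)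
    (he : e ∈ IsManifold.maximalAtlas 𝓘(ℂ, CN N) ω M) {c : ℂ} (hc : c ≠ 0) {r : Fin N → ℝ}
    (hF : ∀ x ∈ e.target, localField F e x = fun j => c * r j * x j) {ε : ℝ}
    (hε : ball 0 ε ⊆ e.target) (w : CN N) :
    DifferentiableOn ℂ (fun ζ => φ (e.symm (diagFlow r ζ w))) {ζ | diagFlow r ζ w ∈ ball 0 ε} := by
  have hcont : Continuous fun ζ => diagFlow r (-(c * ζ)) w :=
    continuous_iff_continuousAt.2 fun ζ => (hasDerivAt_diagFlow r c w ζ).continuousAt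
  have h1 := hφ.differentiableOn_chart he (isOpen_ball.preimage hcont) (fun ζ hζ =>
    ⟨hε hζ, by
      rw [hF _ (hε hζ)]
      exact hasDerivAt_diagFlow r c w ζ⟩)
  have h2 : ∀ ζ : ℂ, -(c * (-ζ / c)) = ζ := fun ζ => by field_simp
  have h3 := h1.comp (f := fun ζ : ℂ => -ζ / c) (s := {ζ | diagFlow r ζ w ∈ ball 0 ε})
    (by fun_prop) (fun ζ hζ => by simpa only [mem_preimage, mem_ofPred_eq, h2] using hζ)
  simpa only [Function.comp_def, h2] using h3

/-- Forward times lead from `w` to `0`, so its leaf meets every neighbourhood of `z₀`. The curve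
starts one unit earlier, at `v`, so that `w` lies over an interior point of the open half-plane on
which the curve is defined. -/
theorem mem_sat_of_diagFlow (he : e ∈ IsManifold.maximalAtlas 𝓘(ℂ, CN N) ω M) {z₀ : M}
    (hz₀ : z₀ ∈ e.source) (hz₀' : e z₀ = 0) {c : ℂ} (hc : c ≠ 0) {r : Fin N → ℝ}
    (hF : ∀ x ∈ e.target, localField F e x = fun j => c * r j * x j) {ε ρ : ℝ} (hρ : 0 < ρ)
    (hr : ∀ j, ρ ≤ r j) (hε : ball 0 ε ⊆ e.target) {w : CN N}
    (hw : diagFlow r (-1) w ∈ ball 0 ε) : e.symm w ∈ Sat F z₀ := by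
  refine ⟨leaf F (e.symm w), ⟨⟨_, rfl⟩, fun V hV hzV => ?_⟩, Relation.ReflTransGen.refl⟩
  set v := diagFlow r (-1) w with hv
  have hcurve : IsIntegralCurveOn F (fun ζ => e.symm (diagFlow r (-(c * ζ)) v))
      {ζ | 0 < (-(c * ζ)).re} := by
    refine isIntegralCurveOn_chart_symm he
      (isOpen_lt continuous_const (Complex.continuous_re.comp (by fun_prop))) fun ζ hζ => ?_
    have hmem : diagFlow r (-(c * ζ)) v ∈ e.target := by
      refine hε (mem_ball_zero_iff.2 ?_)
      refine (norm_diagFlow_le (fun j => hρ.le.trans (hr j)) (le_of_lt hζ) v).trans_lt ?_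
      simpa using hw
    rw [hF _ hmem]
    exact ⟨hmem, hasDerivAt_diagFlow r c v ζ⟩
  have hconv : IsPreconnected {ζ : ℂ | 0 < (-(c * ζ)).re} := by
    refine Convex.isPreconnected ?_
    exact (convex_halfSpace_re_gt 0).is_linear_preimage (f := fun ζ : ℂ => -(c * ζ))
      ⟨fun x y => by ring, fun a x => by simp [mul_left_comm]⟩
  have hsymm : Tendsto e.symm (𝓝 0) (𝓝 z₀) := by
    have h1 := e.continuousAt_symm (e.map_source hz₀)
    rwa [ContinuousAt, hz₀', ← hz₀', e.left_inv hz₀, hz₀'] at h1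
  obtain ⟨n, hn⟩ := ((hsymm.comp (tendsto_diagFlow_natCast hρ hr v)).eventually
    (hV.mem_nhds hzV)).exists
  have h2 : ∀ s : ℂ, -(c * (-s / c)) = s := fun s => by field_simp
  refine ⟨_, Relation.ReflTransGen.single ⟨_, _, hcurve, hconv, ⟨-1 / c, ?_, ?_⟩,
    ⟨-(n + 1) / c, ?_, rfl⟩⟩, ?_⟩
  · simp only [mem_ofPred_eq, h2]
    simp
  · simp only [h2, hv]
    rw [diagFlow_add]
    have h3 : diagFlow r 0 w = w := by
      funext j
      simp [diagFlow]
    simp [h3]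
  · simp only [mem_ofPred_eq, h2]
    simp
    positivity
  · simp only [h2]
    exact hn

theorem HasTaylorSeriesAt.hasPolynomialApprox {z₀ : M} (hT : HasTaylorSeriesAt N φ z₀)
    (he : e ∈ IsManifold.maximalAtlas 𝓘(ℂ, CN N) ω M) (hz₀ : z₀ ∈ e.source) (hz₀' : e z₀ = 0)
    (n : ℕ) : HasPolynomialApprox n fun w => φ (e.symm w) := by
  obtain ⟨e', he', hz, hz', hT⟩ := hT
  have h0 : (0 : CN N) ∈ e.target := hz₀' ▸ e.map_source hz₀
  have hsymm0 : e.symm 0 = z₀ := by rw [← hz₀', e.left_inv hz₀]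
  have h1 : ContMDiffAt 𝓘(ℂ, CN N) 𝓘(ℂ, CN N) ω (e' ∘ e.symm) 0 :=
    ContMDiffAt.comp 0 (by
      rw [hsymm0]
      exact contMDiffAt_of_mem_maximalAtlas he' hz) (contMDiffAt_symm_of_mem_maximalAtlas he h0)
  have h2 : AnalyticAt ℂ (e' ∘ e.symm) 0 := by
    rw [← analyticWithinAt_univ]
    exact contDiffWithinAt_omega_iff_analyticWithinAt.1 h1.contDiffAt
  refine (hT.hasPolynomialApprox_comp h2 (by simp [hsymm0, hz']) n).congr ?_
  have h3 : ContinuousAt e.symm 0 := e.continuousAt_symm h0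
  have h4 : ∀ᶠ w in 𝓝 0, e.symm w ∈ e'.source :=
    h3.eventually_mem (by rw [hsymm0]; exact e'.open_source.mem_nhds hz)
  filter_upwards [h4] with w hw
  simp [e'.left_inv hw]

theorem mem_regularSet_of_diag (hφ : IsFHolomorphic F φ)
    (he : e ∈ IsManifold.maximalAtlas 𝓘(ℂ, CN N) ω M) {z₀ : M}
    (hz₀ : z₀ ∈ e.source) (hz₀' : e z₀ = 0) {c : ℂ} (hc : c ≠ 0) {r : Fin N → ℝ}
    (hF : ∀ x ∈ e.target, localField F e x = fun j => c * r j * x j) {ρ : ℝ} (hρ : 0 < ρ)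
    (hr : ∀ j, ρ ≤ r j) (hT : HasTaylorSeriesAt N φ z₀) :
    z₀ ∈ regularSet (N := N) (Sat F z₀) φ := by
  have hP := hT.hasPolynomialApprox he hz₀ hz₀'
  -- Approximation of order `0` already makes `φ` bounded near `z₀`.
  obtain ⟨C, hC⟩ := (hP 0).isBigO_one.bound
  have h0 : (0 : CN N) ∈ e.target := hz₀' ▸ e.map_source hz₀
  obtain ⟨ε, hε, hb⟩ := Metric.eventually_nhds_iff_ball.1 (hC.and (e.open_target.mem_nhds h0))
  have hεt : ball 0 ε ⊆ e.target := fun w hw => (hb w hw).2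
  obtain ⟨δ, hδ, hd⟩ := exists_differentiableOn_ball_of_diagFlow hε hρ hr
    (fun w hw => by simpa using (hb w hw).1)
    (fun w _ => hφ.differentiableOn_diagFlow he hc hF hεt w) hP
  have hfin : ∀ᶠ w in 𝓝 (e z₀), e.symm w ∈ Sat F z₀ ∧
      MDifferentiableAt 𝓘(ℂ, CN N) 𝓘(ℂ, ℂ) φ (e.symm w) := by
    rw [hz₀']
    have h1 : ∀ᶠ w in 𝓝 0, diagFlow r (-1) w ∈ ball 0 ε := by
      refine (continuous_diagFlow r (-1)).continuousAt.eventually_mem ?_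
      have : diagFlow r (-1) 0 = 0 := by
        funext j
        simp [diagFlow]
      rw [this]
      exact ball_mem_nhds _ hε
    filter_upwards [h1, ball_mem_nhds 0 hδ, e.open_target.mem_nhds h0] with w hw1 hw2 hwt
    exact ⟨mem_sat_of_diagFlow he hz₀ hz₀' hc hF hρ hr hεt hw1, mdifferentiableAt_of_chart he hwt
      (hd.differentiableAt (isOpen_ball.mem_nhds hw2))⟩
  filter_upwards [(e.continuousAt hz₀).eventually hfin, e.eventually_left_inverse hz₀] with y hy hy'
  rwa [hy'] at hy

variable [IsManifold 𝓘(ℂ, CN N) ω M]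

/-- A leaf of the saturation meets the open regular set, since this contains `z₀`; from that point
regularity spreads over the whole leaf. -/
theorem mem_regularSet_of_mem_sat (hF : IsHolomorphicField F) (hφ : IsFHolomorphic F φ) {z₀ q : M}
    (hz₀ : z₀ ∈ regularSet (N := N) (Sat F z₀) φ) (hq : q ∈ Sat F z₀) :
    q ∈ regularSet (N := N) (Sat F z₀) φ := by
  obtain ⟨_, ⟨⟨p, rfl⟩, hp⟩, hqp⟩ := hq
  obtain ⟨v, hvp, hv⟩ := hp _ (isOpen_regularSet _ _) hz₀
  exact mem_regularSet_of_mem_leaf hF hφ (fun _ _ => mem_sat_of_onCommonCurve)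
    (mem_leaf_trans (mem_leaf_symm hvp) hqp) hv

end FHol

end

theorem theorem6p2 {N : ℕ} {M : Type*} [TopologicalSpace M] [T2Space M]
    [ChartedSpace (FHol.CN N) M] [IsManifold 𝓘(ℂ, FHol.CN N) ω M]
    (F : (z : M) → TangentSpace 𝓘(ℂ, FHol.CN N) z) (hF : FHol.IsHolomorphicField F)
    (z₀ : M) (hz₀ : FHol.IsIsolatedCriticalPoint F z₀)
    (A : Matrix (Fin N) (Fin N) ℂ) (hA : FHol.IsLinearizableAt F z₀ A) (hdiag : A.IsDiag)
    (hratio : ∀ a b : ℂ, Module.End.HasEigenvalue (Matrix.toLin' A) a →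
      Module.End.HasEigenvalue (Matrix.toLin' A) b → ∃ r : ℝ, 0 < r ∧ a / b = (r : ℂ))
    (φ : M → ℂ) (hφ : FHol.IsFHolomorphic F φ) (hT : FHol.HasTaylorSeriesAt N φ z₀) :
    IsOpen (FHol.Sat F z₀) ∧
      MDifferentiableOn 𝓘(ℂ, FHol.CN N) 𝓘(ℂ, ℂ) φ (FHol.Sat F z₀) := by
  obtain ⟨d, rfl⟩ : ∃ d, A = Matrix.diagonal d := ⟨A.diag, hdiag.diagonal_diag.symm⟩
  have heig : ∀ j, Module.End.HasEigenvalue (Matrix.toLin' (Matrix.diagonal d)) (d j) :=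
    fun j => (hasEigenvalue_toLin'_diagonal_iff d).2 ⟨j, rfl⟩
  obtain ⟨c, hc, r, hd, ρ, hρ, hr⟩ :=
    exists_eq_mul_ofReal fun i j => hratio _ _ (heig i) (heig j)
  obtain ⟨Φ, hΦ, hz, hlin⟩ := hA
  have hd0 : ∀ j, d j ≠ 0 := fun j => by
    rw [hd j]
    exact mul_ne_zero hc (by exact_mod_cast (hρ.trans_le (hr j)).ne')
  -- The linearizing chart is not assumed centred, but `F z₀ = 0` and the nonzero eigenvalues force
  -- it to be.
  have hΦ0 : Φ z₀ = 0 := by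
    have h1 := hlin z₀ hz
    rw [hz₀.1] at h1
    have h2 : (Matrix.diagonal d).mulVec (Φ z₀) = 0 := by
      rw [← h1]
      exact map_zero (mfderiv 𝓘(ℂ, FHol.CN N) 𝓘(ℂ, FHol.CN N) Φ z₀)
    funext j
    have h3 := congrFun h2 j
    rw [Matrix.mulVec_diagonal] at h3
    exact (mul_eq_zero.1 h3).resolve_left (hd0 j)
  have hfield : ∀ x ∈ Φ.target, FHol.localField F Φ x = fun j => c * r j * x j := by
    intro x hx
    have h1 := hlin _ (Φ.map_target hx)
    rw [Φ.right_inv hx] at h1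
    refine h1.trans (funext fun j => ?_)
    rw [Matrix.mulVec_diagonal, hd j]
  have key := fun q => FHol.mem_regularSet_of_mem_sat (q := q) hF hφ
    (FHol.mem_regularSet_of_diag hφ hΦ hz hΦ0 hc hfield hρ hr hT)
  exact ⟨isOpen_iff_eventually.2 fun q hq => (key q hq).mono fun _ h => h.1,
    fun q hq => (Filter.Eventually.self_of_nhds (key q hq)).2.mdifferentiableWithinAt⟩
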